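/- Let $K\subset\mathbb R^3$ be a regular convex cone, i.e. a closed convex cone with non-empty interior containing no line. Suppose that $K$ is not ellipsoidal (not the image of the circular cone $\{x_0\ge\sqrt{x_1^2+x_2^2}\}$ under an invertible linear map) and that $\partial K\setminus\{0\}$ is a surface of class $C^k$, $k\ge5$, which is everywhere positively curved, i.e. its second fundamental form with respect to the inward normal is positive in every tangent direction other than that of the ray through the point. Let $\gamma$ be the projective image of $\partial K\setminus\{0\}$ in $\mathbb{RP}^2$. A $2\pi$-periodic parametrization of $\gamma$ is a continuous $2\pi$-periodic map $t\mapsto\gamma(t)$ from $\mathbb R$ onto $\gamma$ which is injective on $[0,2\pi)$. It is called balanced if there exist a $2\pi$-periodic lift $y:\mathbb R\to\partial K\setminus\{0\}$ of $\gamma(t)$ of class $C^3$, a constant $\alpha\in\mathbb R$ and a function $\beta:\mathbb R\to\mathbb R$ such that $$y'''(t)+2\alpha\,y'(t)+\beta(t)\,y(t)=0\qquad\text{for all }t\in\mathbb R.$$ Then any two balanced $2\pi$-periodic parametrizations of $\gamma$ that run through $\gamma$ in the same direction differ by an additive constant; without the condition on the direction, they differ by an additive constant up to reversal of the direction. Precisely,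 let $\gamma_1,\gamma_2$ be two balanced $2\pi$-periodic parametrizations of $\gamma$. Then there exists $c\in\mathbb R$ such that either $\gamma_1(t)=\gamma_2(t+c)$ for all $t$, or $\gamma_1(t)=\gamma_2(c-t)$ for all $t$. Moreover, if $s:\mathbb R\to\mathbb R$ is any continuous strictly increasing function with $\gamma_1(t)=\gamma_2(s(t))$ for all $t$, then there exists $c\in\mathbb R$ such that $s(t)=t+c$ for all $t$. -/

import Mathlib

open scoped LinearAlgebra.Projectivization Topology

/-- Euclidean three-space. -/
abbrev E3 : Type := EuclideanSpace ℝ (Fin 3)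

/-- A regular convex cone: a closed convex cone (this is `ProperCone`) with non-empty interior
and containing no line. -/
structure IsRegularCone (K : ProperCone ℝ E3) : Prop where
  interior_nonempty : (interior (K : Set E3)).Nonempty
  no_line : ∀ x ∈ K, -x ∈ K → x = 0

/-- The boundary of the cone `K`, with the apex removed, is of class `C^k` and everywhere
positively curved. Near each boundary point `p ≠ 0` the cone is a sublevel set `{f ≤ 0}` of a
`C^k` function with `df(p) ≠ 0`, and the second fundamental form of the boundary at `p` (which is
a positive multiple of the Hessian of `f` restricted to the tangent plane `ker df(p)`) is positive
in every tangent direction other than that of the ray through `p`, in which it vanishes. -/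
def HasPositivelyCurvedBoundary (k : ℕ) (K : ProperCone ℝ E3) : Prop :=
  ∀ p ∈ frontier (K : Set E3), p ≠ 0 →
    ∃ (U : Set E3) (f : E3 → ℝ), IsOpen U ∧ p ∈ U ∧ ContDiffOn ℝ k f U ∧
      (∀ x ∈ U, x ∈ K ↔ f x ≤ 0) ∧
      fderiv ℝ f p ≠ 0 ∧
      ∀ v : E3, fderiv ℝ f p v = 0 → v ∉ Submodule.span ℝ {p} →
        0 < fderiv ℝ (fderiv ℝ f) p v v

/-- A cone is ellipsoidal if it is the image of the circular cone `{x₁² + x₂² ≤ x₀², 0 ≤ x₀}`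
under an invertible linear map. -/
def IsEllipsoidal (K : ProperCone ℝ E3) : Prop :=
  ∃ A : E3 ≃ₗ[ℝ] E3, (K : Set E3) = A '' {x : E3 | √(x 1 ^ 2 + x 2 ^ 2) ≤ x 0}

/-- The projective image of the boundary of `K` in the real projective plane. -/
def projectiveBoundary (K : ProperCone ℝ E3) : Set (ℙ ℝ E3) :=
  {q | ∃ (v : E3) (hv : v ≠ 0), v ∈ frontier (K : Set E3) ∧ Projectivization.mk ℝ v hv = q}

/-- `y` is a lift of the projective curve `γ`. -/
def IsLift (y : ℝ → E3) (γ : ℝ → ℙ ℝ E3) : Prop :=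
  ∀ t, ∃ h : y t ≠ 0, Projectivization.mk ℝ (y t) h = γ t

/-- A `2π`-periodic parametrization of the projective image of `∂K`: a continuous map `γ` from
the real line onto this curve, running through the curve exactly once in each period.
Continuity of a map from the line to the projective plane amounts to the existence of a
continuous lift. -/
structure IsPeriodicParametrization (K : ProperCone ℝ E3) (γ : ℝ → ℙ ℝ E3) : Prop where
  continuous : ∃ y : ℝ → E3, Continuous y ∧ IsLift y γ
  periodic : Function.Periodic γ (2 * Real.pi)
  injOn : Set.InjOn γ (Set.Ico 0 (2 * Real.pi))
  range_eq : Set.range γ = projectiveBoundary K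

/-- `y` is a vector-valued solution of the equation `[y''' + 2 α y' + α' y] + β y = 0`. -/
structure IsSolution (α β : ℝ → ℝ) (y : ℝ → E3) : Prop where
  contDiff : ContDiff ℝ 3 y
  differentiable : Differentiable ℝ α
  eq_zero : ∀ t, (iteratedDeriv 3 y t + (2 * α t) • deriv y t + deriv α t • y t) + β t • y t = 0

/-- A `2π`-periodic parametrization `γ` of the projective image of `∂K` is balanced if it has a
`2π`-periodic lift to `∂K` which solves `[y''' + 2 α y' + α' y] + β y = 0` for a constant `α` and
some function `β`. As `y` has no zeros and is of class `C³` and `2π`-periodic, `β` is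
automatically continuous and `2π`-periodic. -/
def IsBalanced (K : ProperCone ℝ E3) (γ : ℝ → ℙ ℝ E3) : Prop :=
  IsPeriodicParametrization K γ ∧
    ∃ (y : ℝ → E3) (a : ℝ) (β : ℝ → ℝ),
      IsLift y γ ∧ (∀ t, y t ∈ frontier (K : Set E3)) ∧ Function.Periodic y (2 * Real.pi) ∧
        IsSolution (fun _ => a) β y

/-! The heart of the matter is the bound a < 1/2 for the constant of a balanced lift of a
non-ellipsoidal cone (`lt_half`). Fix t₀. Then f(t) = det(y(t₀), y'(t₀), y(t)) solves the equation
y''' + 2a y' + β y = 0, and g(t) = det(y(t), y'(t), y(t₀)) solves the adjoint one. Multiplied by the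
Wronskian, both are positive on (t₀, t₀ + 2π), because each tangent plane supports K and touches the
curve at one point only (`wronskian_mul_det3_pos`). The bilinear concomitant of f and g is constant
and vanishes at t₀, which gives U'' = -(a/2 + (3/16)(f'/f - g'/g)²) U for U = (fg)^(1/4). If a ≥
1/2, Sturm comparison with sin((t - t₀)/2) forces equality: a = 1/2, f and g are proportional, and β
= 0 (`eq_zero_of_adjoint_pair`). Then y''' + y' = 0, the curve is a conic and K is ellipsoidal.

For two balanced lifts write y = r · (z ∘ σ). Constancy of both Wronskians makes r σ' constant;
comparing coefficients in the two equations gives 2 r r'' - r'² + 2a r² = const, and differentiation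
gives r''' + 2a r' = 0 (`exists_factor`). As r is 2π-periodic and a < 1/2, r is constant: the
frequency √(2a) is too small for other periodic solutions (`deriv_eq_zero_of_periodic`). Hence σ is
affine; its slope is an integer by periodicity and at most 1 in modulus by injectivity. -/

/-! ### Determinants of three vectors -/

/-- The determinant of three vectors in Euclidean three-space. -/
def det3 (u v w : E3) : ℝ :=
  u 0 * (v 1 * w 2 - v 2 * w 1) - u 1 * (v 0 * w 2 - v 2 * w 0) + u 2 * (v 0 * w 1 - v 1 * w 0)

lemma det3_cramer (u v w x : E3) :
    det3 u v w • x = det3 x v w • u + det3 u x w • v + det3 u v x • w := by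
  ext i
  fin_cases i <;> simp [det3] <;> ring

lemma HasDerivAt.apply_fin3 {u : ℝ → E3} {u' : E3} {t : ℝ} (h : HasDerivAt u u' t) (i : Fin 3) :
    HasDerivAt (fun t => u t i) (u' i) t :=
  ((EuclideanSpace.proj i : E3 →L[ℝ] ℝ).hasFDerivAt.comp_hasDerivAt t h)

lemma HasDerivAt.det3 {u v w : ℝ → E3} {u' v' w' : E3} {t : ℝ} (hu : HasDerivAt u u' t)
    (hv : HasDerivAt v v' t) (hw : HasDerivAt w w' t) :
    HasDerivAt (fun t => det3 (u t) (v t) (w t))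
      (_root_.det3 u' (v t) (w t) + _root_.det3 (u t) v' (w t) + _root_.det3 (u t) (v t) w') t := by
  have U := fun i => hu.apply_fin3 i
  have V := fun i => hv.apply_fin3 i
  have Z := fun i => hw.apply_fin3 i
  have := (((U 0).mul (((V 1).mul (Z 2)).sub ((V 2).mul (Z 1)))).sub
    ((U 1).mul (((V 0).mul (Z 2)).sub ((V 2).mul (Z 0))))).add
    ((U 2).mul (((V 0).mul (Z 1)).sub ((V 1).mul (Z 0))))
  refine (this.congr_deriv ?_).congr_of_eventuallyEq (Filter.Eventually.of_forall fun t => ?_)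
  · simp [_root_.det3]; ring
  · simp [_root_.det3]

lemma hasDerivAt_clm_comp (l : E3 →L[ℝ] ℝ) {u : ℝ → E3} {u' : E3} {t : ℝ}
    (h : HasDerivAt u u' t) : HasDerivAt (fun t => l (u t)) (l u') t :=
  l.hasFDerivAt.comp_hasDerivAt t h

/-! ### Uniqueness for linear differential equations -/

/-- A non-negative function whose growth rate is bounded vanishes as soon as it has a zero. -/
lemma eq_zero_of_abs_deriv_le {E E' : ℝ → ℝ} {M t₀ : ℝ} (hE : ∀ t, HasDerivAt E (E' t) t)
    (h0 : ∀ t, 0 ≤ E t) (hM : ∀ t, |E' t| ≤ M * E t) (ht₀ : E t₀ = 0) (t : ℝ) : E t = 0 := by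
  -- Grönwall: E exp(-Mt) decreases from its zero at t₀ onwards, and E exp(Mt) increases up to that
  -- zero.
  have key : ∀ c t, HasDerivAt (fun t => E t * Real.exp (c * t))
      ((E' t + c * E t) * Real.exp (c * t)) t := fun c t => by
    have := (hE t).mul ((hasDerivAt_id t).const_mul c).exp
    refine this.congr_deriv ?_
    simp; ring
  refine le_antisymm ?_ (h0 t)
  rcases le_total t₀ t with h | h
  · have : Antitone (fun t => E t * Real.exp (-M * t)) := by
      refine antitone_of_deriv_nonpos (fun t => (key _ t).differentiableAt) fun t => ?_
      rw [(key _ t).deriv]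
      have := (abs_le.1 (hM t)).2
      exact mul_nonpos_of_nonpos_of_nonneg (by linarith) (Real.exp_pos _).le
    have := this h
    simp only [ht₀, zero_mul] at this
    exact nonpos_of_mul_nonpos_left this (Real.exp_pos _)
  · have : Monotone (fun t => E t * Real.exp (M * t)) := by
      refine monotone_of_deriv_nonneg (fun t => (key _ t).differentiableAt) fun t => ?_
      rw [(key _ t).deriv]
      have := (abs_le.1 (hM t)).1
      exact mul_nonneg (by linarith) (Real.exp_pos _).le
    have := this h
    simp only [ht₀, zero_mul] at this
    exact nonpos_of_mul_nonpos_left this (Real.exp_pos _)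

/-- Uniqueness for the scalar equation `f''' + 2 a f' + β f = 0` with bounded `β`. -/
lemma eq_zero_of_third_order {a C t₀ : ℝ} {β f f₁ f₂ : ℝ → ℝ} (hβ : ∀ t, |β t| ≤ C)
    (h0 : ∀ t, HasDerivAt f (f₁ t) t) (h1 : ∀ t, HasDerivAt f₁ (f₂ t) t)
    (h2 : ∀ t, HasDerivAt f₂ (-(2 * a * f₁ t) - β t * f t) t)
    (z0 : f t₀ = 0) (z1 : f₁ t₀ = 0) (z2 : f₂ t₀ = 0) (t : ℝ) : f t = 0 := by
  have key := eq_zero_of_abs_deriv_le (E := fun t => f t ^ 2 + f₁ t ^ 2 + f₂ t ^ 2)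
    (E' := fun t => 2 * f t * f₁ t + 2 * f₁ t * f₂ t +
      2 * f₂ t * (-(2 * a * f₁ t) - β t * f t)) (M := 2 + 2 * |a| + C) (t₀ := t₀) ?_ ?_ ?_ ?_ t
  · have := sq_nonneg (f t); have := sq_nonneg (f₁ t); have := sq_nonneg (f₂ t)
    exact pow_eq_zero_iff (two_ne_zero) |>.1 (by linarith)
  · intro t
    refine ((((h0 t).pow 2).add ((h1 t).pow 2)).add ((h2 t).pow 2)).congr_deriv ?_
    push_cast
    ring
  · intro t; positivity
  · intro t
    have p1 : |2 * f t * f₁ t| ≤ f t ^ 2 + f₁ t ^ 2 :=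
      abs_le.2 ⟨by nlinarith [sq_nonneg (f t + f₁ t)], by nlinarith [sq_nonneg (f t - f₁ t)]⟩
    have p2 : |2 * f₁ t * f₂ t| ≤ f₁ t ^ 2 + f₂ t ^ 2 :=
      abs_le.2 ⟨by nlinarith [sq_nonneg (f₁ t + f₂ t)], by nlinarith [sq_nonneg (f₁ t - f₂ t)]⟩
    have p3 : |2 * f t * f₂ t| ≤ f t ^ 2 + f₂ t ^ 2 :=
      abs_le.2 ⟨by nlinarith [sq_nonneg (f t + f₂ t)], by nlinarith [sq_nonneg (f t - f₂ t)]⟩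
    have e : 2 * f t * f₁ t + 2 * f₁ t * f₂ t + 2 * f₂ t * (-(2 * a * f₁ t) - β t * f t) =
      2 * f t * f₁ t + 2 * f₁ t * f₂ t - 2 * a * (2 * f₁ t * f₂ t) - β t * (2 * f t * f₂ t) := by
      ring
    have q2 : |2 * a * (2 * f₁ t * f₂ t)| ≤ 2 * |a| * (f₁ t ^ 2 + f₂ t ^ 2) := by
      rw [abs_mul, abs_mul 2 a, abs_two]; gcongr
    have hC : 0 ≤ C := (abs_nonneg _).trans (hβ 0)
    have q3 : |β t * (2 * f t * f₂ t)| ≤ C * (f t ^ 2 + f₂ t ^ 2) := by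
      rw [abs_mul]; gcongr; exact hβ t
    simp only [e]
    have r1 := abs_sub (2 * f t * f₁ t + 2 * f₁ t * f₂ t - 2 * a * (2 * f₁ t * f₂ t))
      (β t * (2 * f t * f₂ t))
    have r2 := abs_sub (2 * f t * f₁ t + 2 * f₁ t * f₂ t) (2 * a * (2 * f₁ t * f₂ t))
    have r3 := abs_add_le (2 * f t * f₁ t) (2 * f₁ t * f₂ t)
    have s1 : 0 ≤ |a| * f t ^ 2 := by positivity
    have s2 : 0 ≤ C * f₁ t ^ 2 := by positivity
    nlinarith [sq_nonneg (f t), sq_nonneg (f₂ t)]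
  · simp [z0, z1, z2]

/-! ### Balanced lifts and their supporting planes -/

/-- A curve in the boundary of the cone `K` which solves `y''' + 2 a y' + β y = 0`, together with
its first two derivatives, and which runs once through the projective image of the boundary
in each period. -/
structure IsBalancedLift (K : ProperCone ℝ E3) (γ : ℝ → ℙ ℝ E3) (a : ℝ) (β : ℝ → ℝ)
    (y y₁ y₂ : ℝ → E3) : Prop where
  param : IsPeriodicParametrization K γ
  lift : IsLift y γ
  mem : ∀ t, y t ∈ frontier (K : Set E3)
  periodic : Function.Periodic y (2 * Real.pi)
  deriv₀ : ∀ t, HasDerivAt y (y₁ t) t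
  deriv₁ : ∀ t, HasDerivAt y₁ (y₂ t) t
  deriv₂ : ∀ t, HasDerivAt y₂ (-((2 * a) • y₁ t) - β t • y t) t
  bdd : ∃ C, ∀ t, |β t| ≤ C
  contDiff : ContDiff ℝ 3 y

lemma IsBalanced.exists_lift {K : ProperCone ℝ E3} {γ : ℝ → ℙ ℝ E3} (h : IsBalanced K γ) :
    ∃ a β y y₁ y₂, IsBalancedLift K γ a β y y₁ y₂ := by
  obtain ⟨hp, y, a, β, hl, hf, hper, hs⟩ := h
  have c3 := hs.contDiff
  have eq3 : iteratedDeriv 3 y = deriv (deriv (deriv y)) := by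
    simp [iteratedDeriv_eq_iterate]
  have c2 : ContDiff ℝ 2 (deriv y) := (contDiff_succ_iff_deriv (n := 2)).1 c3 |>.2.2
  have c1 : ContDiff ℝ 1 (deriv (deriv y)) := (contDiff_succ_iff_deriv (n := 1)).1 c2 |>.2.2
  have c0 : Continuous (deriv (deriv (deriv y))) := c1.continuous_deriv le_rfl
  have ode : ∀ t, deriv (deriv (deriv y)) t = -((2 * a) • deriv y t) - β t • y t := fun t => by
    have := hs.eq_zero t
    rw [eq3] at this
    simp only [deriv_const', zero_smul, add_zero] at this
    rw [← sub_eq_zero, ← this]; abel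
  have y0 : ∀ t, y t ≠ 0 := fun t => (hl t).1
  -- Pairing the equation with y recovers β, which is therefore continuous and periodic, hence
  -- bounded.
  have hβ : ∀ t, β t = inner ℝ (y t) (-((2 * a) • deriv y t) - deriv (deriv (deriv y)) t) /
      ‖y t‖ ^ 2 := fun t => by
    rw [ode t, sub_sub_cancel, inner_smul_right, real_inner_self_eq_norm_sq]
    field_simp [norm_ne_zero_iff.2 (y0 t)]
  have per_deriv : ∀ u : ℝ → E3, Function.Periodic u (2 * Real.pi) →
      Function.Periodic (deriv u) (2 * Real.pi) := fun u hu t => by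
    rw [← deriv_comp_add_const, funext hu]
  have hβc : Continuous β := by
    rw [funext hβ]
    have := c3.continuous
    have := c2.continuous
    refine Continuous.div (by fun_prop) (by fun_prop) fun t => ?_
    simpa using y0 t
  have hβp : Function.Periodic β (2 * Real.pi) := fun t => by
    rw [hβ, hβ, hper, per_deriv _ hper, per_deriv _ (per_deriv _ (per_deriv _ hper))]
  have : ∃ C, ∀ t, |β t| ≤ C := by
    obtain ⟨C, hC⟩ := (hβp.isBounded_of_continuous (by positivity) hβc).exists_norm_le
    exact ⟨C, fun t => hC _ ⟨t, rfl⟩⟩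
  refine ⟨a, β, y, _, _, hp, hl, hf, hper,
    fun t => ((c3.differentiable (by norm_num)) t).hasDerivAt,
    fun t => ((c2.differentiable (by norm_num)) t).hasDerivAt,
    fun t => ?_, this, c3⟩
  rw [← ode]
  exact ((c1.differentiable (by norm_num)) t).hasDerivAt

lemma IsRegularCone.exists_support {K : ProperCone ℝ E3} (hreg : IsRegularCone K) {p : E3}
    (hp : p ∈ frontier (K : Set E3)) :
    ∃ l : E3 →L[ℝ] ℝ, (∀ x ∈ K, l x ≤ 0) ∧ l p = 0 ∧ ∀ x ∈ interior (K : Set E3), l x < 0 := by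
  have hconv : Convex ℝ (K : Set E3) := K.toPointedCone.convex
  have hpK : p ∈ K := K.isClosed.frontier_subset hp
  obtain ⟨l, hl⟩ := geometric_hahn_banach_open_point hconv.interior isOpen_interior hp.2
  have hle : ∀ x ∈ K, l x ≤ l p := fun x hx => by
    have : x ∈ closure (interior (K : Set E3)) := by
      rw [hconv.closure_interior_eq_closure_of_nonempty_interior hreg.interior_nonempty]
      exact subset_closure hx
    exact closure_minimal (fun a ha => (hl a ha).le)
      (isClosed_le l.continuous continuous_const) this
  -- Comparison with the points 0 and 2p of the ray through p makes the maximal value zero.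
  have h0 : l p = 0 := by
    have h1 := hle 0 K.zero_mem
    have h2 := hle (p + p) (K.add_mem hpK hpK)
    rw [map_zero] at h1
    rw [map_add] at h2
    linarith
  exact ⟨l, fun x hx => h0 ▸ hle x hx, h0, fun x hx => h0 ▸ hl x hx⟩

lemma ProperCone.smul_mem_of_nonneg (K : ProperCone ℝ E3) {x : E3} (hx : x ∈ K) {c : ℝ}
    (hc : 0 ≤ c) : c • x ∈ K := K.smul_mem hx hc

lemma det3_mul_clm {u v : E3} {l : E3 →L[ℝ] ℝ} (hu : l u = 0) (hv : l v = 0) (w x : E3) :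
    det3 u v w * l x = l w * det3 u v x := by
  have := congrArg l (det3_cramer u v w x)
  simp only [map_add, map_smul, hu, hv, smul_eq_mul] at this
  linarith

namespace IsBalancedLift

variable {K : ProperCone ℝ E3} {γ : ℝ → ℙ ℝ E3} {a : ℝ} {β : ℝ → ℝ} {y y₁ y₂ : ℝ → E3}

lemma ne_zero (h : IsBalancedLift K γ a β y y₁ y₂) (t : ℝ) : y t ≠ 0 := (h.lift t).1

lemma mem_cone (h : IsBalancedLift K γ a β y y₁ y₂) (t : ℝ) : y t ∈ K :=
  K.isClosed.frontier_subset (h.mem t)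

lemma exists_pos_smul (h : IsBalancedLift K γ a β y y₁ y₂) (hreg : IsRegularCone K) {v : E3}
    (hv : v ∈ frontier (K : Set E3)) (hv0 : v ≠ 0) :
    ∃ τ ∈ Set.Ico 0 (2 * Real.pi), ∃ c : ℝ, 0 < c ∧ v = c • y τ := by
  have : Projectivization.mk ℝ v hv0 ∈ Set.range γ := by
    rw [h.param.range_eq]; exact ⟨v, hv0, hv, rfl⟩
  obtain ⟨τ, hτ⟩ := this
  have hpi : 0 < 2 * Real.pi := by positivity
  refine ⟨toIcoMod hpi 0 τ, toIcoMod_mem_Ico' hpi τ, ?_⟩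
  have hy : y (toIcoMod hpi 0 τ) = y τ := by
    rw [← self_sub_toIcoDiv_zsmul]; exact h.periodic.sub_zsmul_eq _
  obtain ⟨h0, hτ'⟩ := h.lift τ
  rw [← hτ', Projectivization.mk_eq_mk_iff'] at hτ
  obtain ⟨c, hc⟩ := hτ
  have hc0 : c ≠ 0 := by
    rintro rfl
    exact h0 (by rw [← hc, zero_smul])
  rcases lt_or_gt_of_ne hc0 with hneg | hpos
  · refine absurd (hreg.no_line v (K.isClosed.frontier_subset hv) ?_) hv0
    have : -v = (-c⁻¹) • y τ := by
      rw [← hc, smul_smul]; field_simp; simp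
    rw [this]
    exact K.smul_mem_of_nonneg (h.mem_cone τ) (by
      rw [Left.nonneg_neg_iff]; exact (inv_lt_zero.2 hneg).le)
  · refine ⟨c⁻¹, inv_pos.2 hpos, ?_⟩
    rw [hy, ← hc, smul_smul, inv_mul_cancel₀ hc0, one_smul]

lemma exists_eq_add (h : IsBalancedLift K γ a β y y₁ y₂) {s t : ℝ} (hst : γ s = γ t) :
    ∃ n : ℤ, t = s + n * (2 * Real.pi) := by
  have hpi : 0 < 2 * Real.pi := by positivity
  have hg : ∀ t, γ (toIcoMod hpi 0 t) = γ t := fun t => by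
    rw [← self_sub_toIcoDiv_zsmul]; exact h.param.periodic.sub_zsmul_eq _
  have := h.param.injOn (toIcoMod_mem_Ico' hpi s) (toIcoMod_mem_Ico' hpi t)
    (by rw [hg, hg, hst])
  obtain ⟨n, hn⟩ := (toIcoMod_eq_toIcoMod hpi).1 this
  exact ⟨n, by rw [zsmul_eq_mul] at hn; linarith⟩

lemma proj_eq_of_smul (h : IsBalancedLift K γ a β y y₁ y₂) {s t c : ℝ} (hst : y s = c • y t) :
    γ s = γ t := by
  obtain ⟨h0, hs⟩ := h.lift s
  obtain ⟨h1, ht⟩ := h.lift t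
  rw [← hs, ← ht, Projectivization.mk_eq_mk_iff']
  exact ⟨c, hst.symm⟩

/-- The Wronskian of the three components of the curve. -/
lemma wronskian_const (h : IsBalancedLift K γ a β y y₁ y₂) (s t : ℝ) :
    det3 (y s) (y₁ s) (y₂ s) = det3 (y t) (y₁ t) (y₂ t) := by
  have key : ∀ t, HasDerivAt (fun t => det3 (y t) (y₁ t) (y₂ t)) 0 t := fun t => by
    refine ((h.deriv₀ t).det3 (h.deriv₁ t) (h.deriv₂ t)).congr_deriv ?_
    simp [det3]; ring
  exact is_const_of_deriv_eq_zero (fun t => (key t).differentiableAt) (fun t => (key t).deriv) s t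

lemma clm_eq_zero (h : IsBalancedLift K γ a β y y₁ y₂) (l : E3 →L[ℝ] ℝ) {t₀ : ℝ}
    (z0 : l (y t₀) = 0) (z1 : l (y₁ t₀) = 0) (z2 : l (y₂ t₀) = 0) (t : ℝ) : l (y t) = 0 := by
  obtain ⟨C, hC⟩ := h.bdd
  exact eq_zero_of_third_order (a := a) hC (fun t => hasDerivAt_clm_comp l (h.deriv₀ t))
    (fun t => hasDerivAt_clm_comp l (h.deriv₁ t))
    (fun t => (hasDerivAt_clm_comp l (h.deriv₂ t)).congr_deriv (by simp)) z0 z1 z2 t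

/-- The curve does not lie in a plane. -/
lemma exists_clm_ne_zero (h : IsBalancedLift K γ a β y y₁ y₂) (hreg : IsRegularCone K)
    (l : E3 →L[ℝ] ℝ) (hl : l ≠ 0) : ∃ t, l (y t) ≠ 0 := by
  by_contra! hz
  obtain ⟨v, hv⟩ : ∃ v, l v ≠ 0 := by
    by_contra! hv
    exact hl (ContinuousLinearMap.ext hv)
  obtain ⟨c, hc, hlc⟩ : ∃ c ∈ interior (K : Set E3), l c ≠ 0 := by
    by_contra! hi
    obtain ⟨c, hc⟩ := hreg.interior_nonempty
    have : ∀ᶠ ε : ℝ in 𝓝 0, c + ε • v ∈ interior (K : Set E3) := by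
      have hcont : ContinuousAt (fun ε : ℝ => c + ε • v) 0 := by fun_prop
      exact hcont (isOpen_interior.mem_nhds (by simpa using hc))
    obtain ⟨ε, hε, hε0⟩ := ((this.filter_mono nhdsWithin_le_nhds).and
      (self_mem_nhdsWithin : {x : ℝ | x ≠ 0} ∈ 𝓝[≠] 0)).exists
    have h1 := hi _ hε
    rw [map_add, map_smul, hi c hc, zero_add, smul_eq_mul] at h1
    exact (mul_ne_zero hε0 hv) h1
  have hfr : ∀ x ∈ frontier (K : Set E3), l x = 0 := fun x hx => by
    rcases eq_or_ne x 0 with rfl | hx0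
    · exact map_zero l
    · obtain ⟨τ, -, c, -, rfl⟩ := h.exists_pos_smul hreg hx hx0
      rw [map_smul, hz, smul_zero]
  -- If the curve lay in ker l, so would the whole frontier. The open half-space H on the side of c
  -- would then miss the frontier and, being connected, lie in K; its closure contains the line
  -- through y 0.
  set H : Set E3 := {x | 0 < l c * l x} with hH
  have hconv : Convex ℝ H := by
    have : H = (l c • l : E3 →L[ℝ] ℝ) ⁻¹' Set.Ioi 0 := by ext; simp [hH]
    rw [this]
    exact (convex_Ioi 0).is_linear_preimage (l c • l : E3 →L[ℝ] ℝ).toLinearMap.isLinear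
  have hsub : ∀ x ∈ H, x ∈ K := by
    by_contra! hx
    obtain ⟨x, hxH, hxK⟩ := hx
    have hcH : c ∈ H := mul_self_pos.2 hlc
    have hcov : H ⊆ interior (K : Set E3) ∪ (K : Set E3)ᶜ := fun z hzH => by
      by_contra hn
      rw [Set.mem_union, not_or, Set.mem_compl_iff, not_not] at hn
      have := hfr z (K.isClosed.frontier_eq ▸ ⟨hn.2, hn.1⟩)
      simp [hH, this] at hzH
    obtain ⟨z, -, hz, hz'⟩ := hconv.isPreconnected _ _ isOpen_interior
      K.isClosed.isOpen_compl hcov ⟨c, hcH, hc⟩ ⟨x, hxH, hxK⟩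
    exact hz' (interior_subset hz)
  have hm : -y 0 ∈ K := by
    have hlim : Filter.Tendsto (fun ε : ℝ => -y 0 + ε • c) (𝓝[>] 0) (𝓝 (-y 0)) := by
      have : Continuous (fun ε : ℝ => -y 0 + ε • c) := by fun_prop
      simpa using (this.tendsto 0).mono_left nhdsWithin_le_nhds
    refine K.isClosed.mem_of_tendsto hlim ?_
    filter_upwards [self_mem_nhdsWithin] with ε (hε : 0 < ε)
    refine hsub _ ?_
    have : 0 < l c * (ε * l c) := by
      have := mul_pos hε (mul_self_pos.2 hlc); nlinarith
    simpa [hH, hz] using this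
  exact h.ne_zero 0 (hreg.no_line _ (h.mem_cone 0) hm)

lemma wronskian_ne_zero (h : IsBalancedLift K γ a β y y₁ y₂) (hreg : IsRegularCone K) (t : ℝ) :
    det3 (y t) (y₁ t) (y₂ t) ≠ 0 := by
  intro hW
  let M : Matrix (Fin 3) (Fin 3) ℝ := Matrix.of ![fun i => y t i, fun i => y₁ t i, fun i => y₂ t i]
  have hM : M.det = 0 := by
    rw [← hW, Matrix.det_fin_three]; simp [M, det3]; ring
  obtain ⟨v, hv, hMv⟩ := Matrix.exists_mulVec_eq_zero_iff.2 hM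
  have hinner : ∀ u : E3, innerSL ℝ (WithLp.toLp 2 v : E3) u = u 0 * v 0 + u 1 * v 1 + u 2 * v 2 :=
    fun u => by simp [PiLp.inner_apply, Fin.sum_univ_three]
  have hrow : ∀ i, M i 0 * v 0 + M i 1 * v 1 + M i 2 * v 2 = 0 := fun i => by
    have := congrFun hMv i
    simpa [Matrix.mulVec, dotProduct, Fin.sum_univ_three] using this
  obtain ⟨s, hs⟩ := h.exists_clm_ne_zero hreg (innerSL ℝ (WithLp.toLp 2 v : E3)) (fun h0 => by
    have h1 := congrArg (fun l : E3 →L[ℝ] ℝ => l (WithLp.toLp 2 v : E3)) h0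
    have h2 : (WithLp.toLp 2 v : E3) = 0 := by simpa using h1
    exact hv (by simpa using h2))
  exact hs (h.clm_eq_zero _ (t₀ := t) (by rw [hinner]; exact hrow 0) (by rw [hinner]; exact hrow 1)
    (by rw [hinner]; exact hrow 2) s)

/-- The supporting functional at a point of the curve. -/
lemma exists_support (h : IsBalancedLift K γ a β y y₁ y₂) (hreg : IsRegularCone K) (t₀ : ℝ) :
    ∃ l : E3 →L[ℝ] ℝ, (∀ x ∈ K, l x ≤ 0) ∧ (∀ x ∈ interior (K : Set E3), l x < 0) ∧
      l (y t₀) = 0 ∧ l (y₁ t₀) = 0 ∧ l (y₂ t₀) < 0 := by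
  obtain ⟨l, hl, h0, hli⟩ := hreg.exists_support (h.mem t₀)
  have d0 := fun t => hasDerivAt_clm_comp l (h.deriv₀ t)
  have d1 := fun t => hasDerivAt_clm_comp l (h.deriv₁ t)
  have hle : ∀ t, l (y t) ≤ 0 := fun t => hl _ (h.mem_cone t)
  have hmax : IsLocalMax (fun t => l (y t)) t₀ :=
    Filter.Eventually.of_forall fun t => by simpa only [h0] using hle t
  have h1 : l (y₁ t₀) = 0 := hmax.hasDerivAt_eq_zero (d0 t₀)
  have hd0 : deriv (fun t => l (y t)) = fun t => l (y₁ t) := funext fun t => (d0 t).deriv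
  have hd1 : deriv (fun t => l (y₁ t)) = fun t => l (y₂ t) := funext fun t => (d1 t).deriv
  have hne : l (y₂ t₀) ≠ 0 := fun h2 => by
    obtain ⟨c, hc⟩ := hreg.interior_nonempty
    obtain ⟨s, hs⟩ := h.exists_clm_ne_zero hreg l (fun hl0 => by simpa [hl0] using hli c hc)
    exact hs (h.clm_eq_zero l h0 h1 h2 s)
  -- A positive second derivative would make the maximum of l ∘ y at t₀ also a local minimum, so l ∘
  -- y would be locally constant and its second derivative zero.
  refine ⟨l, hl, hli, h0, h1, lt_of_le_of_ne (not_lt.1 fun hpos => hne ?_) hne⟩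
  have hmin := isLocalMin_of_deriv_deriv_pos (f := fun t => l (y t)) (x₀ := t₀)
    (by rw [hd0, hd1]; exact hpos) (by rw [hd0]; exact h1) (d0 t₀).continuousAt
  have he : (fun t => l (y t)) =ᶠ[𝓝 t₀] fun _ => 0 := by
    filter_upwards [hmin] with t ht
    simp only [h0] at ht
    exact le_antisymm (hle t) ht
  have := he.deriv.deriv_eq
  rw [hd0, hd1] at this
  simpa using this

/-- A tangent plane meets the curve only at the point of tangency. -/
lemma exists_eq_add_of_clm_eq_zero (h : IsBalancedLift K γ a β y y₁ y₂) (hreg : IsRegularCone K)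
    {l : E3 →L[ℝ] ℝ} (hl : ∀ x ∈ K, l x ≤ 0) (hli : ∀ x ∈ interior (K : Set E3), l x < 0)
    {t₀ t₁ : ℝ} (h0 : l (y t₀) = 0) (h1 : l (y t₁) = 0) :
    ∃ n : ℤ, t₁ = t₀ + n * (2 * Real.pi) := by
  by_contra hn
  have hpar : ∀ c : ℝ, y t₀ ≠ c • y t₁ := fun c hc => hn (h.exists_eq_add (h.proj_eq_of_smul hc))
  let v : ℝ → E3 := fun μ => (1 - μ) • y t₀ + μ • y t₁
  have hv0 : ∀ μ ∈ Set.Ioo (0 : ℝ) 1, v μ ≠ 0 := fun μ hμ hz => by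
    have h2 : 1 - μ ≠ 0 := by have := hμ.2; intro; linarith
    refine hpar (-(1 - μ)⁻¹ * μ) ?_
    have : (1 - μ) • y t₀ = -(μ • y t₁) := eq_neg_of_add_eq_zero_left hz
    rw [mul_smul, neg_smul, ← smul_neg, ← this, smul_smul, inv_mul_cancel₀ h2, one_smul]
  have hvf : ∀ μ ∈ Set.Ioo (0 : ℝ) 1, v μ ∈ frontier (K : Set E3) := fun μ hμ => by
    rw [K.isClosed.frontier_eq]
    refine ⟨K.add_mem (K.smul_mem_of_nonneg (h.mem_cone _) (by linarith [hμ.2]))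
      (K.smul_mem_of_nonneg (h.mem_cone _) hμ.1.le), fun hi => ?_⟩
    have := hli _ hi
    simp [v, h0, h1] at this
  have hex : ∀ μ, ∃ τ, μ ∈ Set.Ioo (0 : ℝ) 1 →
      τ ∈ Set.Ico 0 (2 * Real.pi) ∧ ∃ c : ℝ, 0 < c ∧ v μ = c • y τ := fun μ => by
    by_cases hμ : μ ∈ Set.Ioo (0 : ℝ) 1
    · obtain ⟨τ, hτ, hc⟩ := h.exists_pos_smul hreg (hvf μ hμ) (hv0 μ hμ)
      exact ⟨τ, fun _ => ⟨hτ, hc⟩⟩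
    · exact ⟨0, fun h => absurd h hμ⟩
  choose τ hτ using hex
  -- Two contact points put a whole segment into the frontier, so l ∘ y has infinitely many zeros in
  -- one period. All are critical points, being maxima; at an accumulation point l ∘ y vanishes to
  -- second order, hence identically.
  let Z : Set ℝ := {t | t ∈ Set.Icc 0 (2 * Real.pi) ∧ l (y t) = 0}
  have hinf : Z.Infinite := by
    refine Set.infinite_of_injOn_mapsTo (s := Set.Ioo (0 : ℝ) 1) (f := τ) ?_ ?_
      (Set.Ioo_infinite one_pos)
    · intro μ hμ ν hν he
      obtain ⟨-, c, hc, hvc⟩ := hτ μ hμ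
      obtain ⟨-, d, hd, hvd⟩ := hτ ν hν
      rw [← he] at hvd
      have e1 : d • v μ = c • v ν := by rw [hvc, hvd, smul_smul, smul_smul, mul_comm]
      have e2 : (d * (1 - μ) - c * (1 - ν)) • y t₀ = (c * ν - d * μ) • y t₁ := by
        simp only [v, smul_add, smul_smul] at e1
        rw [sub_smul, sub_smul, sub_eq_sub_iff_add_eq_add, e1, add_comm]
      have e3 : d * (1 - μ) - c * (1 - ν) = 0 := by
        by_contra hne
        refine hpar ((d * (1 - μ) - c * (1 - ν))⁻¹ * (c * ν - d * μ)) ?_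
        rw [mul_smul, ← e2, smul_smul, inv_mul_cancel₀ hne, one_smul]
      rw [e3, zero_smul] at e2
      have e4 : c * ν - d * μ = 0 := (smul_eq_zero.1 e2.symm).resolve_right (h.ne_zero _)
      have e5 : d = c := by linarith
      rw [e5, ← mul_sub, mul_eq_zero] at e4
      linarith [e4.resolve_left hc.ne']
    · intro μ hμ
      obtain ⟨hI, c, hc, hvc⟩ := hτ μ hμ
      refine ⟨Set.Ico_subset_Icc_self hI, ?_⟩
      have : l (v μ) = 0 := by simp [v, h0, h1]
      rw [hvc, map_smul, smul_eq_mul] at this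
      exact (mul_eq_zero.1 this).resolve_left hc.ne'
  obtain ⟨t, -, ht⟩ := hinf.exists_accPt_of_subset_isCompact (K := Set.Icc 0 (2 * Real.pi))
    isCompact_Icc (fun t ht => ht.1)
  rw [accPt_iff_frequently] at ht
  have d0 := fun t => hasDerivAt_clm_comp l (h.deriv₀ t)
  have d1 := fun t => hasDerivAt_clm_comp l (h.deriv₁ t)
  have crit : ∀ s, l (y s) = 0 → l (y₁ s) = 0 := fun s hs => by
    have hmax : IsLocalMax (fun t => l (y t)) s :=
      Filter.Eventually.of_forall fun t => by simpa only [hs] using hl _ (h.mem_cone t)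
    exact hmax.hasDerivAt_eq_zero (d0 s)
  have z0 : l (y t) = 0 := by
    by_contra hne
    refine ht ?_
    filter_upwards [(d0 t).continuousAt.eventually_ne hne] with s hs hs'
    exact hs hs'.2.2
  have z2 : l (y₂ t) = 0 := by
    by_contra hne
    refine ht ?_
    have := eventually_nhdsWithin_iff.1 ((d1 t).eventually_ne (c := 0) hne)
    filter_upwards [this] with s hs hs'
    exact hs hs'.1 (crit s hs'.2.2)
  obtain ⟨c, hc⟩ := hreg.interior_nonempty
  obtain ⟨s, hs⟩ := h.exists_clm_ne_zero hreg l (fun hl0 => by simpa [hl0] using hli c hc)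
  exact hs (h.clm_eq_zero l z0 (crit t z0) z2 s)

/-- Every tangent plane of the curve is supporting, with contact at a single point. -/
lemma wronskian_mul_det3_pos (h : IsBalancedLift K γ a β y y₁ y₂) (hreg : IsRegularCone K)
    {s t : ℝ} (hst : ∀ n : ℤ, t ≠ s + n * (2 * Real.pi)) :
    0 < det3 (y s) (y₁ s) (y₂ s) * det3 (y s) (y₁ s) (y t) := by
  obtain ⟨l, hl, hli, h0, h1, h2⟩ := h.exists_support hreg s
  have hlt : l (y t) < 0 := lt_of_le_of_ne (hl _ (h.mem_cone t)) fun hz => by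
    obtain ⟨n, hn⟩ := h.exists_eq_add_of_clm_eq_zero hreg hl hli h0 hz
    exact hst n hn
  have hW := mul_self_pos.2 (h.wronskian_ne_zero hreg s)
  -- The functional l is proportional to det(y s, y₁ s, ·), and it is negative both at y₂ s and at y
  -- t.
  have key := det3_mul_clm h0 h1 (y₂ s) (y t)
  by_contra! hn
  have := mul_nonneg_of_nonpos_of_nonpos h2.le hn
  have h3 := mul_neg_of_pos_of_neg hW hlt
  rw [mul_assoc, key] at h3
  linarith

end IsBalancedLift

/-! ### Sturm comparison and the bound on the constant -/

lemma HasDerivAt.eq_zero_of_eqOn {F : ℝ → ℝ} {F' t : ℝ} {s : Set ℝ} (hs : IsOpen s) (ht : t ∈ s)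
    (hF : ∀ x ∈ s, F x = 0) (h : HasDerivAt F F' t) : F' = 0 := by
  have : F =ᶠ[𝓝 t] fun _ => 0 := Filter.eventually_of_mem (hs.mem_nhds ht) hF
  exact h.unique ((hasDerivAt_const t (0 : ℝ)).congr_of_eventuallyEq this)

/-- Let `U > 0` on an interval of length `2π`, and let `M = U' φ - U φ'` with
`φ(t) = sin ((t - t₀) / 2)`. If `M` is non-increasing, then it vanishes. -/
lemma sturm_wronskian_eq_zero {t₀ : ℝ} {U U' : ℝ → ℝ}
    (hU : ∀ t ∈ Set.Ioo t₀ (t₀ + 2 * Real.pi), 0 < U t)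
    (hU' : ∀ t ∈ Set.Ioo t₀ (t₀ + 2 * Real.pi), HasDerivAt U (U' t) t)
    (hM : AntitoneOn (fun t => U' t * Real.sin ((t - t₀) / 2) -
      U t * (Real.cos ((t - t₀) / 2) / 2)) (Set.Ioo t₀ (t₀ + 2 * Real.pi)))
    {t₁ : ℝ} (ht₁ : t₁ ∈ Set.Ioo t₀ (t₀ + 2 * Real.pi)) :
    U' t₁ * Real.sin ((t₁ - t₀) / 2) - U t₁ * (Real.cos ((t₁ - t₀) / 2) / 2) = 0 := by
  set M : ℝ → ℝ := fun t => U' t * Real.sin ((t - t₀) / 2) -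
      U t * (Real.cos ((t - t₀) / 2) / 2) with hMdef
  change M t₁ = 0
  have hφ : ∀ t ∈ Set.Ioo t₀ (t₀ + 2 * Real.pi), 0 < Real.sin ((t - t₀) / 2) := fun t ht =>
    Real.sin_pos_of_pos_of_lt_pi (by linarith [ht.1]) (by linarith [ht.2])
  have dh : ∀ t, HasDerivAt (fun t : ℝ => (t - t₀) / 2) (1 / 2) t := fun t =>
    ((hasDerivAt_id t).sub_const t₀).div_const 2
  -- Since (U/φ)' = M/φ² and (2 cot((t - t₀)/2))' = -1/φ², the derivative of R is (M - M t₁)/φ². If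
  -- M t₁ > 0, R stays below R t₁ to the left of t₁, and the limit at t₀ gives 2 M t₁ ≤ 0. If M t₁ <
  -- 0, the right end gives -2 M t₁ ≤ 0. No boundary values of U are needed.
  set R : ℝ → ℝ := fun t => (U t + 2 * M t₁ * Real.cos ((t - t₀) / 2)) /
    Real.sin ((t - t₀) / 2) with hR
  have dR : ∀ t ∈ Set.Ioo t₀ (t₀ + 2 * Real.pi),
      HasDerivAt R ((M t - M t₁) / Real.sin ((t - t₀) / 2) ^ 2) t := fun t ht => by
    refine (((hU' t ht).add ((dh t).cos.const_mul (2 * M t₁))).div (dh t).sin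
      (hφ t ht).ne').congr_deriv ?_
    have := Real.sin_sq_add_cos_sq ((t - t₀) / 2)
    congr 1
    simp only [hMdef, Pi.add_apply]
    linear_combination -(M t₁) * this
  have hRle : ∀ t ∈ Set.Ioo t₀ (t₀ + 2 * Real.pi), R t ≤ R t₁ →
      2 * M t₁ * Real.cos ((t - t₀) / 2) ≤ R t₁ * Real.sin ((t - t₀) / 2) := fun t ht hle => by
    have := (div_le_iff₀ (hφ t ht)).1 hle
    linarith [hU t ht]
  have hcont : Continuous fun t : ℝ => 2 * M t₁ * Real.cos ((t - t₀) / 2) := by fun_prop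
  have hcont' : Continuous fun t : ℝ => R t₁ * Real.sin ((t - t₀) / 2) := by fun_prop
  refine le_antisymm (not_lt.1 fun hpos => ?_) (not_lt.1 fun hneg => ?_)
  · have hmono : MonotoneOn R (Set.Ioc t₀ t₁) := by
      have hsub : Set.Ioc t₀ t₁ ⊆ Set.Ioo t₀ (t₀ + 2 * Real.pi) :=
        fun t ht => ⟨ht.1, ht.2.trans_lt ht₁.2⟩
      refine monotoneOn_of_deriv_nonneg (convex_Ioc _ _)
        (fun t ht => (dR t (hsub ht)).continuousAt.continuousWithinAt)
        (fun t ht => (dR t (hsub (interior_subset ht))).differentiableAt.differentiableWithinAt)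
        fun t ht => ?_
      have ht' := interior_subset ht
      rw [(dR t (hsub ht')).deriv]
      exact div_nonneg (sub_nonneg.2 (hM (hsub ht') ht₁ ht'.2)) (sq_nonneg _)
    have hev : ∀ᶠ t in 𝓝[>] t₀, 2 * M t₁ * Real.cos ((t - t₀) / 2) ≤
        R t₁ * Real.sin ((t - t₀) / 2) := by
      filter_upwards [Ioo_mem_nhdsGT ht₁.1] with t ht
      exact hRle t ⟨ht.1, ht.2.trans ht₁.2⟩
        (hmono ⟨ht.1, ht.2.le⟩ ⟨ht₁.1, le_rfl⟩ ht.2.le)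
    have := le_of_tendsto_of_tendsto ((hcont.tendsto t₀).mono_left nhdsWithin_le_nhds)
      ((hcont'.tendsto t₀).mono_left nhdsWithin_le_nhds) hev
    simp at this
    linarith
  · have hmono : AntitoneOn R (Set.Ico t₁ (t₀ + 2 * Real.pi)) := by
      have hsub : Set.Ico t₁ (t₀ + 2 * Real.pi) ⊆ Set.Ioo t₀ (t₀ + 2 * Real.pi) :=
        fun t ht => ⟨ht₁.1.trans_le ht.1, ht.2⟩
      refine antitoneOn_of_deriv_nonpos (convex_Ico _ _)
        (fun t ht => (dR t (hsub ht)).continuousAt.continuousWithinAt)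
        (fun t ht => (dR t (hsub (interior_subset ht))).differentiableAt.differentiableWithinAt)
        fun t ht => ?_
      have ht' := interior_subset ht
      rw [(dR t (hsub ht')).deriv]
      exact div_nonpos_of_nonpos_of_nonneg (sub_nonpos.2 (hM ht₁ (hsub ht') ht'.1)) (sq_nonneg _)
    have hev : ∀ᶠ t in 𝓝[<] (t₀ + 2 * Real.pi), 2 * M t₁ * Real.cos ((t - t₀) / 2) ≤
        R t₁ * Real.sin ((t - t₀) / 2) := by
      filter_upwards [Ioo_mem_nhdsLT ht₁.2] with t ht
      exact hRle t ⟨ht₁.1.trans ht.1, ht.2⟩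
        (hmono ⟨le_rfl, ht₁.2⟩ ⟨ht.1.le, ht.2⟩ ht.1.le)
    have := le_of_tendsto_of_tendsto
      ((hcont.tendsto (t₀ + 2 * Real.pi)).mono_left nhdsWithin_le_nhds)
      ((hcont'.tendsto (t₀ + 2 * Real.pi)).mono_left nhdsWithin_le_nhds) hev
    have e : (t₀ + 2 * Real.pi - t₀) / 2 = Real.pi := by ring
    rw [e, Real.cos_pi, Real.sin_pi] at this
    linarith

/-- If a solution of `f''' + 2 a f' + β f = 0` and a solution of the adjoint equation
`g''' + 2 a g' - β g = 0`, both with a double zero at `t₀`, are positive up to `t₀ + 2π`, then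
`a ≤ 1 / 2`, with equality only if `β` vanishes. -/
lemma eq_zero_of_adjoint_pair {a t₀ : ℝ} (ha : 1 / 2 ≤ a) {β f f₁ f₂ g g₁ g₂ : ℝ → ℝ}
    (hf : ∀ t, HasDerivAt f (f₁ t) t) (hf₁ : ∀ t, HasDerivAt f₁ (f₂ t) t)
    (hf₂ : ∀ t, HasDerivAt f₂ (-(2 * a * f₁ t) - β t * f t) t)
    (hg : ∀ t, HasDerivAt g (g₁ t) t) (hg₁ : ∀ t, HasDerivAt g₁ (g₂ t) t)
    (hg₂ : ∀ t, HasDerivAt g₂ (-(2 * a * g₁ t) + β t * g t) t)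
    (zf : f t₀ = 0) (zf₁ : f₁ t₀ = 0) (zg : g t₀ = 0)
    (pf : ∀ t ∈ Set.Ioo t₀ (t₀ + 2 * Real.pi), 0 < f t)
    (pg : ∀ t ∈ Set.Ioo t₀ (t₀ + 2 * Real.pi), 0 < g t) :
    ∀ t ∈ Set.Ioo t₀ (t₀ + 2 * Real.pi), a = 1 / 2 ∧ β t = 0 := by
  -- The bilinear concomitant of the equation and its adjoint: the terms in β cancel in its
  -- derivative.
  have hconc : ∀ t, f t * g₂ t - f₁ t * g₁ t + f₂ t * g t + 2 * a * (f t * g t) = 0 := by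
    have key : ∀ t, HasDerivAt
        (fun t => f t * g₂ t - f₁ t * g₁ t + f₂ t * g t + 2 * a * (f t * g t)) 0 t := fun t => by
      refine (((((hf t).mul (hg₂ t)).sub ((hf₁ t).mul (hg₁ t))).add ((hf₂ t).mul (hg t))).add
        (((hf t).mul (hg t)).const_mul (2 * a))).congr_deriv ?_
      ring
    intro t
    rw [is_const_of_deriv_eq_zero (fun t => (key t).differentiableAt) (fun t => (key t).deriv) t t₀]
    simp [zf, zf₁, zg]
  set I := Set.Ioo t₀ (t₀ + 2 * Real.pi) with hI
  have hφ : ∀ t ∈ I, 0 < Real.sin ((t - t₀) / 2) := fun t ht =>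
    Real.sin_pos_of_pos_of_lt_pi (by linarith [ht.1]) (by linarith [ht.2])
  have dh : ∀ t, HasDerivAt (fun t : ℝ => (t - t₀) / 2) (1 / 2) t := fun t =>
    ((hasDerivAt_id t).sub_const t₀).div_const 2
  -- This is (fg)^(1/4). With the fourth root, the quadratic terms in f'/f and g'/g in U''/U combine
  -- to a negative multiple of the square of their difference.
  let U : ℝ → ℝ := fun t => Real.exp ((Real.log (f t) + Real.log (g t)) / 4)
  let U' : ℝ → ℝ := fun t => U t * ((f₁ t / f t + g₁ t / g t) / 4)
  have dU : ∀ t ∈ I, HasDerivAt U (U' t) t := fun t ht =>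
    ((((hf t).log (pf t ht).ne').add ((hg t).log (pg t ht).ne')).div_const 4).exp
  have pU : ∀ t, 0 < U t := fun t => Real.exp_pos _
  let M : ℝ → ℝ := fun t => U' t * Real.sin ((t - t₀) / 2) - U t * (Real.cos ((t - t₀) / 2) / 2)
  have dM : ∀ t ∈ I, HasDerivAt M (U t * Real.sin ((t - t₀) / 2) *
      (-(3 / 16) * (f₁ t / f t - g₁ t / g t) ^ 2 + 1 / 4 - a / 2)) t := fun t ht => by
    have hf0 := (pf t ht).ne'
    have hg0 := (pg t ht).ne'
    refine ((((dU t ht).mul ((((hf₁ t).div (hf t) hf0).add ((hg₁ t).div (hg t) hg0)).div_const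
      4)).mul (dh t).sin).sub ((dU t ht).mul ((dh t).cos.div_const 2))).congr_deriv ?_
    have e : f₂ t / f t + g₂ t / g t = f₁ t / f t * (g₁ t / g t) - 2 * a := by
      field_simp
      linear_combination hconc t
    have e1 : (f₂ t * f t - f₁ t * f₁ t) / f t ^ 2 = f₂ t / f t - (f₁ t / f t) ^ 2 := by
      field_simp
    have e2 : (g₂ t * g t - g₁ t * g₁ t) / g t ^ 2 = g₂ t / g t - (g₁ t / g t) ^ 2 := by
      field_simp
    rw [e1, e2]
    simp only [U', Pi.add_apply, Pi.mul_apply, Pi.div_apply]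
    linear_combination U t * Real.sin ((t - t₀) / 2) / 4 * e
  have hquad : ∀ t, -(3 / 16) * (f₁ t / f t - g₁ t / g t) ^ 2 + 1 / 4 - a / 2 ≤ 0 := fun t => by
    nlinarith [sq_nonneg (f₁ t / f t - g₁ t / g t)]
  have hanti : AntitoneOn M I := by
    refine antitoneOn_of_deriv_nonpos (convex_Ioo _ _)
      (fun t ht => (dM t ht).continuousAt.continuousWithinAt)
      (fun t ht => (dM t (interior_subset ht)).differentiableAt.differentiableWithinAt)
      fun t ht => ?_
    have ht' := interior_subset ht
    rw [(dM t ht').deriv]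
    exact mul_nonpos_of_nonneg_of_nonpos (mul_nonneg (pU t).le (hφ t ht').le) (hquad t)
  have hM0 : ∀ t ∈ I, M t = 0 := fun t ht =>
    sturm_wronskian_eq_zero (fun t _ => pU t) dU hanti ht
  have hq0 : ∀ t ∈ I, a = 1 / 2 ∧ f₁ t * g t - f t * g₁ t = 0 := fun t ht => by
    have h0 := (dM t ht).eq_zero_of_eqOn isOpen_Ioo ht hM0
    have h1 := (mul_eq_zero.1 h0).resolve_left (mul_pos (pU t) (hφ t ht)).ne'
    have h2 := sq_nonneg (f₁ t / f t - g₁ t / g t)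
    have h3 : (f₁ t / f t - g₁ t / g t) ^ 2 = 0 := by nlinarith
    refine ⟨by nlinarith, ?_⟩
    have h4 := pow_eq_zero_iff (two_ne_zero) |>.1 h3
    rw [div_sub_div _ _ (pf t ht).ne' (pg t ht).ne', div_eq_zero_iff] at h4
    exact h4.resolve_right (mul_pos (pf t ht) (pg t ht)).ne'
  have hJ1 : ∀ t ∈ I, f₂ t * g t - f t * g₂ t = 0 := fun t ht => by
    have := (((hf₁ t).mul (hg t)).sub ((hf t).mul (hg₁ t))).eq_zero_of_eqOn isOpen_Ioo ht
      (fun t ht => (hq0 t ht).2)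
    linarith
  intro t ht
  refine ⟨(hq0 t ht).1, ?_⟩
  have hJ2 := (((hf₂ t).mul (hg t)).sub ((hf t).mul (hg₂ t))).eq_zero_of_eqOn isOpen_Ioo ht hJ1
  have hfg := (mul_pos (pf t ht) (pg t ht)).ne'
  have e0 := (hq0 t ht).2
  have e1 := hJ1 t ht
  -- The 1-jets and the pairs (f, f₂), (g, g₂) are proportional, so the remaining minor vanishes
  -- too. In the derivative of f₂ g - f g₂ = 0 only -2 β f g then survives.
  have e2 : f₂ t * g₁ t - f₁ t * g₂ t = 0 := by
    have : (f t * g t) * (f₂ t * g₁ t - f₁ t * g₂ t) = 0 := by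
      linear_combination (-f₂ t * g t) * e0 + f₁ t * g t * e1
    exact (mul_eq_zero.1 this).resolve_left hfg
  have : (2 * (f t * g t)) * β t = 0 := by
    linear_combination -hJ2 + e2 - 2 * a * e0
  exact (mul_eq_zero.1 this).resolve_left (by simpa using hfg)

namespace IsBalancedLift

variable {K : ProperCone ℝ E3} {γ : ℝ → ℙ ℝ E3} {a : ℝ} {β : ℝ → ℝ} {y y₁ y₂ : ℝ → E3}

lemma eq_half_of_half_le (h : IsBalancedLift K γ a β y y₁ y₂) (hreg : IsRegularCone K)
    (ha : 1 / 2 ≤ a) (t : ℝ) : a = 1 / 2 ∧ β t = 0 := by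
  have hpi := Real.pi_pos
  -- The given t becomes the midpoint of the interval of comparison.
  set t₀ := t - Real.pi with ht₀
  set W := det3 (y t₀) (y₁ t₀) (y₂ t₀) with hW
  have hWs : ∀ s, det3 (y s) (y₁ s) (y₂ s) = W := fun s => h.wronskian_const s t₀
  have key := eq_zero_of_adjoint_pair ha (β := β) (t₀ := t₀)
    (f := fun t => W * det3 (y t₀) (y₁ t₀) (y t))
    (f₁ := fun t => W * det3 (y t₀) (y₁ t₀) (y₁ t))
    (f₂ := fun t => W * det3 (y t₀) (y₁ t₀) (y₂ t))
    (g := fun t => W * det3 (y t) (y₁ t) (y t₀))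
    (g₁ := fun t => W * det3 (y t) (y₂ t) (y t₀))
    -- In the derivative of det(y, y₂, y t₀), y''' is replaced by means of the equation; its β y
    -- part drops out.
    (g₂ := fun t => W * (det3 (y₁ t) (y₂ t) (y t₀) - 2 * a * det3 (y t) (y₁ t) (y t₀)))
    ?_ ?_ ?_ ?_ ?_ ?_ ?_ ?_ ?_ ?_ ?_ t ⟨by linarith, by linarith⟩
  · exact key
  · intro t
    refine (((hasDerivAt_const t (y t₀)).det3 (hasDerivAt_const t (y₁ t₀))
      (h.deriv₀ t)).const_mul W).congr_deriv ?_
    simp [det3]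
  · intro t
    refine (((hasDerivAt_const t (y t₀)).det3 (hasDerivAt_const t (y₁ t₀))
      (h.deriv₁ t)).const_mul W).congr_deriv ?_
    simp [det3]
  · intro t
    refine (((hasDerivAt_const t (y t₀)).det3 (hasDerivAt_const t (y₁ t₀))
      (h.deriv₂ t)).const_mul W).congr_deriv ?_
    simp [det3]; ring
  · intro t
    refine (((h.deriv₀ t).det3 (h.deriv₁ t) (hasDerivAt_const t (y t₀))).const_mul W).congr_deriv ?_
    simp [det3]; left; ring
  · intro t
    refine (((h.deriv₀ t).det3 (h.deriv₂ t) (hasDerivAt_const t (y t₀))).const_mul W).congr_deriv ?_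
    simp [det3]; left; ring
  · intro t
    refine ((((h.deriv₁ t).det3 (h.deriv₂ t) (hasDerivAt_const t (y t₀))).sub
      (((h.deriv₀ t).det3 (h.deriv₁ t) (hasDerivAt_const t (y t₀))).const_mul
        (2 * a))).const_mul W).congr_deriv ?_
    simp [det3]; ring
  · simp [det3]; ring_nf; simp
  · simp [det3]; ring_nf; simp
  · simp [det3]; ring_nf; simp
  · intro t ht
    refine h.wronskian_mul_det3_pos hreg fun n hn => ?_
    have h1 : 0 < (n : ℝ) * (2 * Real.pi) := by linarith [ht.1]
    have h2 : (n : ℝ) * (2 * Real.pi) < 1 * (2 * Real.pi) := by linarith [ht.2]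
    have h3 : (0 : ℝ) < n := pos_of_mul_pos_left h1 (by positivity)
    have h4 : (n : ℝ) < 1 := lt_of_mul_lt_mul_right h2 (by positivity)
    norm_cast at h3 h4
    omega
  · intro t ht
    rw [← hWs t]
    refine h.wronskian_mul_det3_pos hreg fun n hn => ?_
    have h1 : 0 < ((-n : ℤ) : ℝ) * (2 * Real.pi) := by push_cast; linarith [ht.1]
    have h2 : ((-n : ℤ) : ℝ) * (2 * Real.pi) < 1 * (2 * Real.pi) := by push_cast; linarith [ht.2]
    have h3 : (0 : ℝ) < (-n : ℤ) := pos_of_mul_pos_left h1 (by positivity)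
    have h4 : ((-n : ℤ) : ℝ) < 1 := lt_of_mul_lt_mul_right h2 (by positivity)
    norm_cast at h3 h4
    omega

end IsBalancedLift

/-! ### The equality case: conics -/

lemma eq_zero_of_det3_ne_zero {u v w : E3} (hW : det3 u v w ≠ 0) {x y z : ℝ}
    (h : x • u + y • v + z • w = 0) : x = 0 ∧ y = 0 ∧ z = 0 := by
  have e : ∀ i, x * u i + y * v i + z * w i = 0 := fun i => by
    simpa using congrArg (fun p : E3 => p i) h
  have e0 := e 0
  have e1 := e 1
  have e2 := e 2
  refine ⟨((mul_eq_zero (a := det3 u v w)).1 ?_).resolve_left hW,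
    ((mul_eq_zero (a := det3 u v w)).1 ?_).resolve_left hW,
    ((mul_eq_zero (a := det3 u v w)).1 ?_).resolve_left hW⟩ <;> simp only [det3]
  · linear_combination (v 1 * w 2 - v 2 * w 1) * e0 - (v 0 * w 2 - v 2 * w 0) * e1 +
      (v 0 * w 1 - v 1 * w 0) * e2
  · linear_combination -(u 1 * w 2 - u 2 * w 1) * e0 + (u 0 * w 2 - u 2 * w 0) * e1 -
      (u 0 * w 1 - u 1 * w 0) * e2
  · linear_combination (u 1 * v 2 - u 2 * v 1) * e0 - (u 0 * v 2 - u 2 * v 0) * e1 +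
      (u 0 * v 1 - u 1 * v 0) * e2

lemma exists_polar (x y : ℝ) :
    ∃ θ, x = √(x ^ 2 + y ^ 2) * Real.sin θ ∧ y = √(x ^ 2 + y ^ 2) * Real.cos θ := by
  refine ⟨Complex.arg ⟨y, x⟩, ?_⟩
  have h : √(x ^ 2 + y ^ 2) = ‖(⟨y, x⟩ : ℂ)‖ := by
    rw [Complex.norm_def, Complex.normSq_mk]; congr 1; ring
  rw [h, Complex.norm_mul_sin_arg, Complex.norm_mul_cos_arg]
  exact ⟨rfl, rfl⟩

namespace IsBalancedLift

variable {K : ProperCone ℝ E3} {γ : ℝ → ℙ ℝ E3} {a : ℝ} {β : ℝ → ℝ} {y y₁ y₂ : ℝ → E3}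

/-- For `a = 1 / 2` and `β = 0` the curve is a conic. -/
lemma eq_trigonometric (h : IsBalancedLift K γ (1 / 2) (fun _ => 0) y y₁ y₂) (t : ℝ) :
    y t = (y 0 + y₂ 0) + Real.sin t • y₁ 0 - Real.cos t • y₂ 0 := by
  have d2 : ∀ t, HasDerivAt y₂ (-y₁ t) t := fun t => (h.deriv₂ t).congr_deriv (by simp)
  have const : ∀ {F : ℝ → E3}, (∀ t, HasDerivAt F 0 t) → F t = F 0 := fun {F} hF =>
    is_const_of_deriv_eq_zero (fun t => (hF t).differentiableAt) (fun t => (hF t).deriv) t 0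
  have e0 := const (F := fun t => y t + y₂ t) fun t =>
    ((h.deriv₀ t).add (d2 t)).congr_deriv (by simp)
  have e1 := const (F := fun t => Real.cos t • y₁ t - Real.sin t • y₂ t) fun t =>
    (((Real.hasDerivAt_cos t).smul (h.deriv₁ t)).sub
      ((Real.hasDerivAt_sin t).smul (d2 t))).congr_deriv (by simp; module)
  have e2 := const (F := fun t => Real.sin t • y₁ t + Real.cos t • y₂ t) fun t =>
    (((Real.hasDerivAt_sin t).smul (h.deriv₁ t)).add
      ((Real.hasDerivAt_cos t).smul (d2 t))).congr_deriv (by simp)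
  simp only [Real.cos_zero, Real.sin_zero, one_smul, zero_smul, sub_zero, zero_add] at e0 e1 e2
  rw [← e0, ← e1, ← e2]
  have : y t = (y t + y₂ t) - (Real.sin t ^ 2 + Real.cos t ^ 2) • y₂ t := by
    rw [Real.sin_sq_add_cos_sq, one_smul, add_sub_cancel_right]
  refine this.trans ?_
  module

lemma isEllipsoidal (h : IsBalancedLift K γ (1 / 2) (fun _ => 0) y y₁ y₂)
    (hreg : IsRegularCone K) : IsEllipsoidal K := by
  set A := y 0 + y₂ 0 with hA
  have hW : det3 A (y₁ 0) (-y₂ 0) ≠ 0 := by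
    have e : det3 A (y₁ 0) (-y₂ 0) = -det3 (y 0) (y₁ 0) (y₂ 0) := by simp [det3, hA]; ring
    rw [e, neg_ne_zero]
    exact h.wronskian_ne_zero hreg 0
  have hy := h.eq_trigonometric
  rw [← hA] at hy
  have hAθ : ∀ t, A = y t + y₂ t := fun t => by
    have d : ∀ t, HasDerivAt (fun t => y t + y₂ t) 0 t := fun t =>
      ((h.deriv₀ t).add (h.deriv₂ t)).congr_deriv (by simp)
    exact is_const_of_deriv_eq_zero (fun t => (d t).differentiableAt) (fun t => (d t).deriv) 0 t
  -- The axis vector A is the midpoint of the opposite points y 0 and y π.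
  have hAK : A ∈ K := by
    have e : A = (2⁻¹ : ℝ) • (y 0 + y Real.pi) := by
      rw [hy 0, hy Real.pi]
      simp only [Real.cos_zero, Real.sin_zero, Real.cos_pi, Real.sin_pi]
      module
    rw [e]
    exact K.smul_mem_of_nonneg (K.add_mem (h.mem_cone _) (h.mem_cone _)) (by norm_num)
  let L : E3 →ₗ[ℝ] E3 :=
    { toFun := fun x => x 0 • A + x 1 • y₁ 0 + x 2 • (-y₂ 0)
      map_add' := fun x z => by simp only [PiLp.add_apply]; module
      map_smul' := fun c x => by
        simp only [PiLp.smul_apply, smul_eq_mul, RingHom.id_apply]; module }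
  have hL : ∀ x, L x = x 0 • A + x 1 • y₁ 0 + x 2 • (-y₂ 0) := fun x => rfl
  have hinj : Function.Injective L := by
    rw [← LinearMap.ker_eq_bot, LinearMap.ker_eq_bot']
    intro x hx
    obtain ⟨h0, h1, h2⟩ := eq_zero_of_det3_ne_zero hW ((hL x).symm.trans hx)
    ext i
    fin_cases i
    exacts [h0, h1, h2]
  have key : ∀ x : E3, ∃ θ,
      L x = (x 0 - √(x 1 ^ 2 + x 2 ^ 2)) • A + √(x 1 ^ 2 + x 2 ^ 2) • y θ := fun x => by
    obtain ⟨θ, h1, h2⟩ := exists_polar (x 1) (x 2)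
    refine ⟨θ, ?_⟩
    generalize √(x 1 ^ 2 + x 2 ^ 2) = r at h1 h2
    rw [hy θ, hL, h1, h2]
    module
  refine ⟨LinearEquiv.ofInjectiveEndo L hinj, ?_⟩
  ext v
  simp only [SetLike.mem_coe, Set.mem_image, Set.mem_ofPred_eq, LinearEquiv.coe_ofInjectiveEndo]
  constructor
  · intro hv
    obtain ⟨x, rfl⟩ := (LinearEquiv.ofInjectiveEndo L hinj).surjective v
    rw [LinearEquiv.coe_ofInjectiveEndo] at hv
    refine ⟨x, ?_, rfl⟩
    obtain ⟨θ, hθ⟩ := key x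
    -- As A = y θ + y₂ θ, the support functional at θ is negative at A, so l (L x) ≤ 0 forces the
    -- coefficient of A to be non-negative.
    obtain ⟨l, hl, -, h0, -, h2⟩ := h.exists_support hreg θ
    have := hl _ hv
    rw [hθ, map_add, map_smul, map_smul, h0, smul_zero, add_zero, hAθ θ, map_add, h0, zero_add,
      smul_eq_mul] at this
    by_contra! hlt
    linarith [mul_pos_of_neg_of_neg (sub_neg.2 hlt) h2]
  · rintro ⟨x, hx, rfl⟩
    obtain ⟨θ, hθ⟩ := key x
    rw [hθ]
    exact K.add_mem (K.smul_mem_of_nonneg hAK (sub_nonneg.2 hx))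
      (K.smul_mem_of_nonneg (h.mem_cone θ) (Real.sqrt_nonneg _))

/-- For a non-ellipsoidal cone the constant of a balanced parametrization is less than `1 / 2`. -/
lemma lt_half (h : IsBalancedLift K γ a β y y₁ y₂) (hreg : IsRegularCone K)
    (hell : ¬ IsEllipsoidal K) : a < 1 / 2 := by
  by_contra! ha
  have h0 := h.eq_half_of_half_le hreg ha
  obtain rfl := (h0 0).1
  obtain rfl : β = fun _ => 0 := funext fun t => (h0 t).2
  exact hell (h.isEllipsoidal hreg)

end IsBalancedLift

/-! ### Smoothness of parameter changes and periodic solutions -/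

/-- With u a point of the curve and v its velocity, q/p is an affine coordinate of the projective
plane in which the curve has unit speed at that point. -/
lemma exists_dual {u v w : E3} (hW : det3 u v w ≠ 0) : ∃ p q : E3 →L[ℝ] ℝ,
    (p u = 1 ∧ p v = 0) ∧ (q u = 0 ∧ q v = 1) := by
  let e : Fin 3 → E3 →L[ℝ] ℝ := fun i => EuclideanSpace.proj i
  have he : ∀ i x, e i x = x i := fun i x => rfl
  refine ⟨(det3 u v w)⁻¹ • ((v 1 * w 2 - v 2 * w 1) • e 0 - (v 0 * w 2 - v 2 * w 0) • e 1 +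
    (v 0 * w 1 - v 1 * w 0) • e 2), (det3 u v w)⁻¹ • ((-(u 1 * w 2 - u 2 * w 1)) • e 0 +
    (u 0 * w 2 - u 2 * w 0) • e 1 - (u 0 * w 1 - u 1 * w 0) • e 2), ⟨?_, ?_⟩, ?_, ?_⟩ <;>
    simp only [smul_apply, add_apply, sub_apply, smul_eq_mul, he]
  · rw [inv_mul_eq_one₀ hW]; simp only [det3]; ring
  · rw [mul_eq_zero]; right; ring
  · rw [mul_eq_zero]; right; ring
  · rw [inv_mul_eq_one₀ hW]; simp only [det3]; ring

lemma ContDiff.exists_hasDerivAt_three {f : ℝ → ℝ} (hf : ContDiff ℝ 3 f) :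
    ∃ f₁ f₂ f₃ : ℝ → ℝ, (∀ t, HasDerivAt f (f₁ t) t) ∧ (∀ t, HasDerivAt f₁ (f₂ t) t) ∧
      ∀ t, HasDerivAt f₂ (f₃ t) t := by
  have c2 : ContDiff ℝ 2 (deriv f) := (contDiff_succ_iff_deriv (n := 2)).1 hf |>.2.2
  have c1 : ContDiff ℝ 1 (deriv (deriv f)) := (contDiff_succ_iff_deriv (n := 1)).1 c2 |>.2.2
  exact ⟨_, _, _, fun t => ((hf.differentiable (by norm_num)) t).hasDerivAt,
    fun t => ((c2.differentiable (by norm_num)) t).hasDerivAt,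
    fun t => ((c1.differentiable (by norm_num)) t).hasDerivAt⟩

/-- A continuous solution `σ` of `F (σ t) = G t` is as smooth as `F` and `G` are, as long as `F`
has non-zero derivative. -/
lemma ContDiffAt.of_comp_eq {F G σ : ℝ → ℝ} {t d : ℝ} {n : WithTop ℕ∞} (hn : n ≠ 0)
    (hF : ContDiffAt ℝ n F (σ t)) (hd : HasDerivAt F d (σ t)) (hd0 : d ≠ 0)
    (hG : ContDiffAt ℝ n G t) (hσ : ContinuousAt σ t) (h : ∀ s, F (σ s) = G s) :
    ContDiffAt ℝ n σ t := by
  have hd' : HasFDerivAt F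
      ((ContinuousLinearEquiv.unitsEquivAut ℝ (Units.mk0 d hd0) : ℝ ≃L[ℝ] ℝ) : ℝ →L[ℝ] ℝ) (σ t) := by
    refine hd.hasFDerivAt.congr_fderiv ?_
    ext; simp
  have hinv := hF.to_localInverse hd' hn
  have hev := hσ.eventually (hF.hasStrictFDerivAt' hd' hn).eventually_left_inverse
  have hcomp : ContDiffAt ℝ n (hF.localInverse hd' hn ∘ G) t := by
    refine ContDiffAt.comp t ?_ hG
    rw [← h t]; exact hinv
  refine hcomp.congr_of_eventuallyEq ?_
  filter_upwards [hev] with s hs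
  rw [Function.comp_apply, ← h s]
  exact hs.symm

/-- A `2π`-periodic solution of `f''' + 2 a f' = 0`, where `2 a < 1`, is constant. -/
lemma deriv_eq_zero_of_periodic {a : ℝ} (ha : a < 1 / 2) {f f₁ f₂ : ℝ → ℝ}
    (hper : Function.Periodic f (2 * Real.pi)) (h0 : ∀ t, HasDerivAt f (f₁ t) t)
    (h1 : ∀ t, HasDerivAt f₁ (f₂ t) t) (h2 : ∀ t, HasDerivAt f₂ (-(2 * a * f₁ t)) t) (t : ℝ) :
    f₁ t = 0 := by
  have hpi := Real.pi_pos
  have per : ∀ {u u' : ℝ → ℝ}, Function.Periodic u (2 * Real.pi) →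
      (∀ t, HasDerivAt u (u' t) t) → Function.Periodic u' (2 * Real.pi) := fun {u u'} hu hd t => by
    have := (hd (t + 2 * Real.pi)).comp_add_const t (2 * Real.pi)
    rw [funext hu] at this
    exact this.unique (hd t)
  have p1 := per hper h0
  have p2 := per p1 h1
  -- Rolle's theorem over one period.
  obtain ⟨t₀, -, z⟩ : ∃ c ∈ Set.Ioo 0 (2 * Real.pi), f₁ c = 0 :=
    exists_hasDerivAt_eq_zero (by linarith)
      (fun t _ => (h0 t).continuousAt.continuousWithinAt) (by simpa using (hper 0).symm)
      fun t _ => h0 t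
  rcases le_or_gt a 0 with ha0 | ha0
  -- For a ≤ 0 the function f' f'' is monotone and vanishes at t₀ and t₀ + 2π, hence in between.
  · have dE : ∀ t, HasDerivAt (fun t => f₁ t * f₂ t) (f₂ t ^ 2 - 2 * a * f₁ t ^ 2) t := fun t =>
      ((h1 t).mul (h2 t)).congr_deriv (by ring)
    have hmono : Monotone fun t => f₁ t * f₂ t := by
      refine monotone_of_deriv_nonneg (fun t => (dE t).differentiableAt) fun t => ?_
      rw [(dE t).deriv]
      nlinarith [sq_nonneg (f₂ t), mul_nonneg (neg_nonneg.2 ha0) (sq_nonneg (f₁ t))]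
    have hconst : ∀ t ∈ Set.Ioo t₀ (t₀ + 2 * Real.pi), f₁ t * f₂ t = 0 := fun t ht => by
      have l1 := hmono ht.1.le
      have l2 := hmono ht.2.le
      simp only [p1 t₀, z, zero_mul] at l1 l2
      exact le_antisymm l2 l1
    have hz : ∀ t ∈ Set.Ioo t₀ (t₀ + 2 * Real.pi), f₂ t = 0 := fun t ht => by
      have := (dE t).eq_zero_of_eqOn isOpen_Ioo ht hconst
      have h3 : f₂ t ^ 2 = 0 := by
        nlinarith [sq_nonneg (f₂ t), mul_nonneg (neg_nonneg.2 ha0) (sq_nonneg (f₁ t))]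
      exact pow_eq_zero_iff two_ne_zero |>.1 h3
    have hIcc : ∀ s ∈ Set.Icc t₀ (t₀ + 2 * Real.pi), f₁ s = f₁ t₀ := by
      refine constant_of_has_deriv_right_zero (fun t _ => (h1 t).continuousAt.continuousWithinAt)
        fun t ht => ?_
      rcases eq_or_lt_of_le ht.1 with rfl | hlt
      · have hcl : t₀ ∈ closure (Set.Ioo t₀ (t₀ + 2 * Real.pi)) := by
          rw [closure_Ioo (by linarith)]; exact ⟨le_rfl, by linarith⟩
        have : f₂ t₀ = 0 := by
          have hc : Continuous f₂ := continuous_iff_continuousAt.2 fun t => (h2 t).continuousAt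
          exact closure_minimal (s := Set.Ioo t₀ (t₀ + 2 * Real.pi)) (t := {t | f₂ t = 0}) hz
            (isClosed_eq hc continuous_const) hcl
        exact this ▸ (h1 t₀).hasDerivWithinAt
      · exact hz t ⟨hlt, ht.2⟩ ▸ (h1 t).hasDerivWithinAt
    have hpos : 0 < 2 * Real.pi := by linarith
    have := hIcc (toIcoMod hpos t₀ t) (Set.Ico_subset_Icc_self (toIcoMod_mem_Ico hpos t₀ t))
    rw [z, ← self_sub_toIcoDiv_zsmul, p1.sub_zsmul_eq] at this
    exact this
  · set ω := √(2 * a) with hω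
    have hω0 : 0 < ω := Real.sqrt_pos.2 (by linarith)
    have hωsq : ω ^ 2 = 2 * a := Real.sq_sqrt (by linarith)
    have hω1 : ω < 1 := by nlinarith
    have dω : ∀ t, HasDerivAt (fun t => ω * (t - t₀)) ω t := fun t => by
      simpa using ((hasDerivAt_id t).sub_const t₀).const_mul ω
    -- The vector (f'', ω f') rotates with angular speed ω. By periodicity it returns after the
    -- angle 2πω, which lies strictly between 0 and 2π, so it is zero.
    have e1 : ∀ t, f₂ t * Real.cos (ω * (t - t₀)) + ω * f₁ t * Real.sin (ω * (t - t₀)) = f₂ t₀ := by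
      have d : ∀ t, HasDerivAt (fun t => f₂ t * Real.cos (ω * (t - t₀)) +
          ω * f₁ t * Real.sin (ω * (t - t₀))) 0 t := fun t => by
        refine (((h2 t).mul (dω t).cos).add (((h1 t).const_mul ω).mul (dω t).sin)).congr_deriv ?_
        rw [← hωsq]; ring
      intro t
      rw [is_const_of_deriv_eq_zero (fun t => (d t).differentiableAt) (fun t => (d t).deriv) t t₀]
      simp
    have e2 : ∀ t, ω * f₁ t * Real.cos (ω * (t - t₀)) - f₂ t * Real.sin (ω * (t - t₀)) = 0 := by
      have d : ∀ t, HasDerivAt (fun t => ω * f₁ t * Real.cos (ω * (t - t₀)) -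
          f₂ t * Real.sin (ω * (t - t₀))) 0 t := fun t => by
        refine ((((h1 t).const_mul ω).mul (dω t).cos).sub ((h2 t).mul (dω t).sin)).congr_deriv ?_
        rw [← hωsq]; ring
      intro t
      rw [is_const_of_deriv_eq_zero (fun t => (d t).differentiableAt) (fun t => (d t).deriv) t t₀]
      simp [z]
    have hB : f₂ t₀ = 0 := by
      have := e1 (t₀ + 2 * Real.pi)
      rw [p1, p2, z, add_sub_cancel_left] at this
      by_contra hne
      have hc : Real.cos (ω * (2 * Real.pi)) = 1 := by
        have h3 : f₂ t₀ * Real.cos (ω * (2 * Real.pi)) = f₂ t₀ * 1 := by linarith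
        exact mul_left_cancel₀ hne h3
      have h4 : 0 < ω * (2 * Real.pi) := by positivity
      have h5 : ω * (2 * Real.pi) < 2 * Real.pi := by nlinarith
      rw [Real.cos_eq_one_iff_of_lt_of_lt (by linarith) h5] at hc
      linarith
    have hs := Real.sin_sq_add_cos_sq (ω * (t - t₀))
    have h3 : ω * f₁ t = 0 := by
      linear_combination Real.sin (ω * (t - t₀)) * (e1 t) + Real.cos (ω * (t - t₀)) * (e2 t) -
        ω * f₁ t * hs + Real.sin (ω * (t - t₀)) * hB
    exact (mul_eq_zero.1 h3).resolve_left hω0.ne'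

/-! ### Comparison of two balanced lifts -/

namespace IsBalancedLift

variable {K : ProperCone ℝ E3} {γ γ' : ℝ → ℙ ℝ E3} {a b : ℝ} {α β : ℝ → ℝ}
  {y y₁ y₂ z z₁ z₂ : ℝ → E3} {σ : ℝ → ℝ}

lemma exists_smooth_factor (h : IsBalancedLift K γ a α y y₁ y₂)
    (h' : IsBalancedLift K γ' b β z z₁ z₂) (hreg : IsRegularCone K) (hσ : Continuous σ)
    (he : ∀ t, γ t = γ' (σ t)) :
    ∃ r : ℝ → ℝ, (∀ t, r t ≠ 0) ∧ (∀ t, y t = r t • z (σ t)) ∧ ContDiff ℝ 3 r ∧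
      ContDiff ℝ 3 σ := by
  have hex : ∀ t, ∃ r : ℝ, y t = r • z (σ t) := fun t => by
    obtain ⟨h0, hs⟩ := h.lift t
    obtain ⟨h1, ht⟩ := h'.lift (σ t)
    have := he t
    rw [← hs, ← ht, Projectivization.mk_eq_mk_iff'] at this
    exact this.imp fun _ h => h.symm
  choose r hr using hex
  have hr0 : ∀ t, r t ≠ 0 := fun t h0 => h.ne_zero t (by rw [hr t, h0, zero_smul])
  have key : ∀ t, ContDiffAt ℝ 3 σ t ∧ ContDiffAt ℝ 3 r t := fun t => by
    obtain ⟨p, q, ⟨pu, pv⟩, qu, qv⟩ := exists_dual (h'.wronskian_ne_zero hreg (σ t))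
    have cz : ∀ l : E3 →L[ℝ] ℝ, ContDiff ℝ 3 fun s => l (z s) := fun l =>
      l.contDiff.comp h'.contDiff
    have cy : ∀ l : E3 →L[ℝ] ℝ, ContDiff ℝ 3 fun s => l (y s) := fun l =>
      l.contDiff.comp h.contDiff
    have hpy : p (y t) ≠ 0 := by rw [hr t, map_smul, pu]; simpa using hr0 t
    have hpz : p (z (σ t)) ≠ 0 := by rw [pu]; exact one_ne_zero
    -- The quotient q/p does not see the factor r, so σ is given implicitly by smooth functions.
    have hσt : ContDiffAt ℝ 3 σ t := by
      refine ContDiffAt.of_comp_eq (F := fun s => q (z s) / p (z s)) (d := 1)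
        (G := fun s => q (y s) / p (y s)) (by norm_num) ((cz q).contDiffAt.div (cz p).contDiffAt hpz)
        ?_ one_ne_zero ((cy q).contDiffAt.div (cy p).contDiffAt hpy) hσ.continuousAt fun s => ?_
      · refine ((hasDerivAt_clm_comp q (h'.deriv₀ _)).div
          (hasDerivAt_clm_comp p (h'.deriv₀ _)) hpz).congr_deriv ?_
        rw [pu, pv, qu, qv]; norm_num
      · rw [hr s, map_smul, map_smul, smul_eq_mul, smul_eq_mul, mul_div_mul_left _ _ (hr0 s)]
    refine ⟨hσt, ?_⟩
    have hq : ContDiffAt ℝ 3 (fun s => p (y s) / p (z (σ s))) t :=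
      (cy p).contDiffAt.div ((cz p).contDiffAt.comp t hσt) hpz
    refine hq.congr_of_eventuallyEq ?_
    have hc : ContinuousAt (fun s => p (z (σ s))) t :=
      ((cz p).continuous.comp hσ).continuousAt
    filter_upwards [hc.eventually_ne hpz] with s hs
    rw [hr s, map_smul, smul_eq_mul, mul_div_cancel_right₀ _ hs]
  exact ⟨r, hr0, hr, contDiff_iff_contDiffAt.2 fun t => (key t).2,
    contDiff_iff_contDiffAt.2 fun t => (key t).1⟩

/-- The factor between the two lifts solves `r''' + 2 a r' = 0` and is inversely proportional to
the derivative of the change of parameter. -/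
lemma exists_factor (h : IsBalancedLift K γ a α y y₁ y₂)
    (h' : IsBalancedLift K γ' b β z z₁ z₂) (hreg : IsRegularCone K) (hσ : Continuous σ)
    (he : ∀ t, γ t = γ' (σ t)) :
    ∃ (r r₁ r₂ σ₁ : ℝ → ℝ) (κ : ℝ), κ ≠ 0 ∧ (∀ t, r t ≠ 0) ∧ (∀ t, y t = r t • z (σ t)) ∧
      (∀ t, HasDerivAt r (r₁ t) t) ∧ (∀ t, HasDerivAt r₁ (r₂ t) t) ∧
      (∀ t, HasDerivAt r₂ (-(2 * a * r₁ t)) t) ∧ (∀ t, HasDerivAt σ (σ₁ t) t) ∧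
      ∀ t, r t * σ₁ t = κ := by
  obtain ⟨r, hr0, hr, cr, cσ⟩ := h.exists_smooth_factor h' hreg hσ he
  obtain ⟨r₁, r₂, r₃, dr, dr₁, dr₂⟩ := cr.exists_hasDerivAt_three
  obtain ⟨s₁, s₂, s₃, ds, ds₁, ds₂⟩ := cσ.exists_hasDerivAt_three
  have dN : ∀ t, HasDerivAt (fun t => z (σ t)) (s₁ t • z₁ (σ t)) t := fun t =>
    (h'.deriv₀ (σ t)).scomp t (ds t)
  have dN₁ : ∀ t, HasDerivAt (fun t => z₁ (σ t)) (s₁ t • z₂ (σ t)) t := fun t =>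
    (h'.deriv₁ (σ t)).scomp t (ds t)
  have dN₂ : ∀ t, HasDerivAt (fun t => z₂ (σ t))
      (s₁ t • (-((2 * b) • z₁ (σ t)) - β (σ t) • z (σ t))) t := fun t =>
    (h'.deriv₂ (σ t)).scomp t (ds t)
  have ey₁ : ∀ t, y₁ t = r₁ t • z (σ t) + (r t * s₁ t) • z₁ (σ t) := fun t => by
    have := h.deriv₀ t
    rw [funext hr] at this
    rw [this.unique ((dr t).smul (dN t))]
    module
  have ey₂ : ∀ t, y₂ t = r₂ t • z (σ t) + (2 * r₁ t * s₁ t + r t * s₂ t) • z₁ (σ t) +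
      (r t * s₁ t ^ 2) • z₂ (σ t) := fun t => by
    have := h.deriv₁ t
    rw [funext ey₁] at this
    rw [this.unique (((dr₁ t).smul (dN t)).add (((dr t).mul (ds₁ t)).smul (dN₁ t)))]
    simp only [Pi.mul_apply]
    module
  have hW : ∀ t, det3 (y t) (y₁ t) (y₂ t) =
      (r t * s₁ t) ^ 3 * det3 (z (σ t)) (z₁ (σ t)) (z₂ (σ t)) := fun t => by
    rw [hr, ey₁, ey₂]
    simp [det3]
    ring
  -- Both Wronskians are constant and non-zero, and the cube is injective on the reals.
  have hκ : ∀ t, r t * s₁ t = r 0 * s₁ 0 := fun t => by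
    have e := h.wronskian_const t 0
    rw [hW, hW, h'.wronskian_const (σ t) (σ 0)] at e
    have := mul_right_cancel₀ (h'.wronskian_ne_zero hreg (σ 0)) e
    exact (Odd.strictMono_pow (by decide : Odd 3)).injective this
  have hκ0 : r 0 * s₁ 0 ≠ 0 := fun h0 => by
    have := hW 0
    rw [h0] at this
    exact h.wronskian_ne_zero hreg 0 (by rw [this]; ring)
  have hs0 : ∀ t, s₁ t ≠ 0 := fun t h0 => hκ0 (by rw [← hκ t, h0, mul_zero])
  have k1 : ∀ t, r₁ t * s₁ t + r t * s₂ t = 0 := fun t =>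
    ((dr t).mul (ds₁ t)).unique
      ((hasDerivAt_const t (r 0 * s₁ 0)).congr_of_eventuallyEq (Filter.Eventually.of_forall hκ))
  have k2 : ∀ t, r₂ t * s₁ t + r₁ t * s₂ t + (r₁ t * s₂ t + r t * s₃ t) = 0 := fun t =>
    (((dr₁ t).mul (ds₁ t)).add ((dr t).mul (ds₂ t))).unique
      ((hasDerivAt_const t (0 : ℝ)).congr_of_eventuallyEq (Filter.Eventually.of_forall k1))
  -- The coefficient of z₁ ∘ σ when the equation of y is expanded in the frame z, z₁, z₂ along σ.
  have k3 : ∀ t, 3 * r₂ t * s₁ t + 3 * r₁ t * s₂ t + r t * s₃ t - 2 * b * (r t * s₁ t ^ 3) +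
      2 * a * (r t * s₁ t) = 0 := fun t => by
    have d := h.deriv₂ t
    rw [funext ey₂] at d
    have e := d.unique ((((dr₂ t).smul (dN t)).add
      (((((dr₁ t).const_mul 2).mul (ds₁ t)).add ((dr t).mul (ds₂ t))).smul (dN₁ t))).add
      (((dr t).mul ((ds₁ t).pow 2)).smul (dN₂ t)))
    rw [ey₁, hr, eq_comm, ← sub_eq_zero] at e
    have := (eq_zero_of_det3_ne_zero (h'.wronskian_ne_zero hreg (σ t))
      (x := r₃ t + 2 * a * r₁ t + α t * r t - r t * s₁ t ^ 3 * β (σ t))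
      (y := 3 * r₂ t * s₁ t + 3 * r₁ t * s₂ t + r t * s₃ t - 2 * b * (r t * s₁ t ^ 3) +
      2 * a * (r t * s₁ t))
      (z := (2 * r₁ t * s₁ t + r t * s₂ t) * s₁ t + r₁ t * s₁ t ^ 2 +
        2 * r t * s₁ t * s₂ t) ?_).2.1
    · exact this
    · rw [← e]
      simp only [Pi.mul_apply, Pi.add_apply, Pi.pow_apply]
      push_cast
      module
  -- The derivatives of r σ' = const eliminate σ'' and σ''' from `k3`. The result is the Schwarzian
  -- relation between a and b, written in terms of r.
  have k4 : ∀ t, 2 * r t * r₂ t - r₁ t ^ 2 + 2 * a * r t ^ 2 =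
      2 * b * (r 0 * s₁ 0) ^ 2 := fun t => by
    refine mul_right_cancel₀ (hs0 t) ?_
    rw [← hκ t]
    linear_combination r t * k3 t - r t * k2 t - r₁ t * k1 t
  have k5 : ∀ t, r₃ t = -(2 * a * r₁ t) := fun t => by
    have := ((((dr t).const_mul 2).mul (dr₂ t)).sub ((dr₁ t).pow 2)).add
      (((dr t).pow 2).const_mul (2 * a)) |>.unique
      ((hasDerivAt_const t _).congr_of_eventuallyEq (Filter.Eventually.of_forall k4))
    refine mul_left_cancel₀ (mul_ne_zero two_ne_zero (hr0 t)) ?_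
    push_cast at this
    linear_combination this
  exact ⟨r, r₁, r₂, s₁, _, hκ0, hr0, hr, dr, dr₁, fun t => k5 t ▸ dr₂ t, ds, hκ⟩

/-- Two balanced parametrizations differ by a translation, up to reversal of the direction. -/
lemma eq_add_or_eq_sub (h : IsBalancedLift K γ a α y y₁ y₂)
    (h' : IsBalancedLift K γ' b β z z₁ z₂) (hreg : IsRegularCone K) (hell : ¬ IsEllipsoidal K)
    (hσ : Continuous σ) (he : ∀ t, γ t = γ' (σ t)) :
    ∃ c, (∀ t, σ t = t + c) ∨ ∀ t, σ t = c - t := by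
  have hpi := Real.pi_pos
  obtain ⟨r, r₁, r₂, s₁, κ, hκ0, hr0, hr, dr, dr₁, dr₂, ds, hκ⟩ := h.exists_factor h' hreg hσ he
  have hper : ∀ t, ∃ n : ℤ, σ (t + 2 * Real.pi) = σ t + n * (2 * Real.pi) := fun t =>
    h'.exists_eq_add (by rw [← he, ← he, h.param.periodic])
  have rper : Function.Periodic r (2 * Real.pi) := fun t => by
    obtain ⟨n, hn⟩ := hper t
    have e := h.periodic t
    rw [hr, hr t, hn, h'.periodic.int_mul n (σ t)] at e
    exact smul_left_injective ℝ (h'.ne_zero (σ t)) e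
  have r0 : ∀ t, r t = r 0 := fun t => by
    have h1 := deriv_eq_zero_of_periodic (h.lt_half hreg hell) rper dr dr₁ dr₂
    exact is_const_of_deriv_eq_zero (fun t => (dr t).differentiableAt)
      (fun t => (dr t).deriv.trans (h1 t)) t 0
  set m := s₁ 0 with hm
  have hs : ∀ t, s₁ t = m := fun t =>
    mul_left_cancel₀ (hr0 0) (by rw [hκ 0, ← r0 t, hκ t])
  have hm0 : m ≠ 0 := fun h0 => hκ0 (by rw [← hκ 0, ← hm, h0, mul_zero])
  have hlin : ∀ t, σ t = m * t + σ 0 := fun t => by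
    have d : ∀ t, HasDerivAt (fun t => σ t - m * t) 0 t := fun t =>
      ((ds t).sub ((hasDerivAt_id t).const_mul m)).congr_deriv (by simp [hs t])
    have := is_const_of_deriv_eq_zero (fun t => (d t).differentiableAt) (fun t => (d t).deriv) t 0
    simp only [mul_zero, sub_zero] at this
    linarith
  obtain ⟨n, hn⟩ := hper 0
  have hmn : m = n := by
    rw [hlin] at hn
    have : m * (2 * Real.pi) = n * (2 * Real.pi) := by linarith
    exact mul_right_cancel₀ (by positivity) this
  -- A steeper slope would bring γ back to γ 0 before the period is over.
  have hle : |m| ≤ 1 := by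
    by_contra! hlt
    have hp : 0 < |m| := by linarith
    have hγ : γ (2 * Real.pi / |m|) = γ 0 := by
      rw [he, he, hlin]
      rcases abs_cases m with ⟨hc, -⟩ | ⟨hc, -⟩
      · rw [hc, mul_div_cancel₀ _ hm0, add_comm, h'.param.periodic]
      · rw [hc, div_neg, mul_neg, mul_div_cancel₀ _ hm0, neg_add_eq_sub, h'.param.periodic.sub_eq]
    have := h.param.injOn ⟨by positivity, by rw [div_lt_iff₀ hp]; nlinarith⟩
      ⟨le_rfl, by positivity⟩ hγ
    have : 0 < 2 * Real.pi / |m| := by positivity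
    linarith
  rw [hmn] at hle hm0
  have hn0 : n ≠ 0 := by exact_mod_cast hm0
  have hn1 : |n| ≤ 1 := by exact_mod_cast hle
  rw [abs_le] at hn1
  have : n = 1 ∨ n = -1 := by omega
  refine ⟨σ 0, this.imp (fun h1 t => ?_) fun h1 t => ?_⟩
  · rw [hlin t, hmn, h1]; push_cast; ring
  · rw [hlin t, hmn, h1]; push_cast; ring

end IsBalancedLift

/-! ### Existence of a continuous change of parameter -/

namespace IsBalancedLift

variable {K : ProperCone ℝ E3} {γ γ' : ℝ → ℙ ℝ E3} {a b : ℝ} {α β : ℝ → ℝ}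
  {y y₁ y₂ z z₁ z₂ : ℝ → E3}

/-- Two parametrizations of the same curve are related by a continuous change of parameter. -/
lemma exists_continuous_reparam (h : IsBalancedLift K γ a α y y₁ y₂)
    (h' : IsBalancedLift K γ' b β z z₁ z₂) (hreg : IsRegularCone K) :
    ∃ σ : ℝ → ℝ, Continuous σ ∧ ∀ t, γ t = γ' (σ t) := by
  have : Fact (0 < 2 * Real.pi) := ⟨by positivity⟩
  have hnorm : ∀ {u v : E3}, u ≠ 0 → v ≠ 0 → ‖u‖⁻¹ • u = ‖v‖⁻¹ • v →
      u = (‖u‖ * ‖v‖⁻¹) • v := fun {u v} hu hv huv => by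
    rw [mul_smul, ← huv, smul_smul, mul_inv_cancel₀ (norm_ne_zero_iff.2 hu), one_smul]
  have hc : ∀ {u : ℝ → E3}, Continuous u → (∀ t, u t ≠ 0) →
      Continuous fun t => ‖u t‖⁻¹ • u t := fun {u} hu hu0 =>
    (hu.norm.inv₀ fun t => norm_ne_zero_iff.2 (hu0 t)).smul hu
  have hper : Function.Periodic (fun t => ‖z t‖⁻¹ • z t) (2 * Real.pi) := fun t => by
    simp only [h'.periodic t]
  -- The normalized lift embeds the circle into the sphere. Since boundary points on the same
  -- projective line through 0 are positive multiples of each other, the normalized y takes values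
  -- in the image; it is pulled back to the circle and then lifted to the line.
  let e : AddCircle (2 * Real.pi) → E3 := hper.lift
  have he : ∀ t : ℝ, e (t : AddCircle (2 * Real.pi)) = ‖z t‖⁻¹ • z t := fun t => hper.lift_coe t
  have hec : Continuous e :=
    (hc h'.contDiff.continuous h'.ne_zero).quotient_liftOn' _
  have hinj : Function.Injective e := by
    intro p q
    induction p using QuotientAddGroup.induction_on with | H s =>
    induction q using QuotientAddGroup.induction_on with | H t =>
    intro hst
    rw [he, he] at hst
    obtain ⟨n, hn⟩ := h'.exists_eq_add
      (h'.proj_eq_of_smul (hnorm (h'.ne_zero s) (h'.ne_zero t) hst))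
    refine QuotientAddGroup.eq.2 ⟨n, ?_⟩
    rw [hn]; simp
  have hemb := hec.isClosedEmbedding hinj
  have hex : ∀ t, ∃ p, e p = ‖y t‖⁻¹ • y t := fun t => by
    obtain ⟨τ, -, c, hc, hy⟩ := h'.exists_pos_smul hreg (h.mem t) (h.ne_zero t)
    refine ⟨(τ : AddCircle (2 * Real.pi)), ?_⟩
    rw [he, hy, norm_smul, Real.norm_of_nonneg hc.le, smul_smul, mul_inv, mul_right_comm,
      inv_mul_cancel₀ hc.ne', one_mul]
  choose θ hθ using hex
  have hθc : Continuous θ := by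
    rw [hemb.isInducing.continuous_iff]
    exact (hc h.contDiff.continuous h.ne_zero).congr fun t => (hθ t).symm
  obtain ⟨t₀, ht₀⟩ := QuotientAddGroup.mk_surjective (θ 0)
  obtain ⟨F, ⟨-, hF⟩, -⟩ := (AddCircle.isCoveringMap_coe
    (2 * Real.pi)).existsUnique_continuousMap_lifts ⟨θ, hθc⟩ 0 t₀ ht₀
  refine ⟨F, F.continuous, fun t => ?_⟩
  have h1 : ((F t : ℝ) : AddCircle (2 * Real.pi)) = θ t := congrFun hF t
  have h2 := hθ t
  rw [← h1, he] at h2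
  obtain ⟨h0, hs⟩ := h.lift t
  obtain ⟨h0', hs'⟩ := h'.lift (F t)
  rw [← hs, ← hs', Projectivization.mk_eq_mk_iff']
  exact ⟨_, (hnorm h0 h0' h2.symm).symm⟩

end IsBalancedLift

theorem mainTheorem2 (k : ℕ) (hk : 5 ≤ k) (K : ProperCone ℝ E3) (hreg : IsRegularCone K)
    (hcurv : HasPositivelyCurvedBoundary k K) (hell : ¬ IsEllipsoidal K)
    (γ₁ γ₂ : ℝ → ℙ ℝ E3) (h₁ : IsBalanced K γ₁) (h₂ : IsBalanced K γ₂) :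
    (∃ c : ℝ, (∀ t, γ₁ t = γ₂ (t + c)) ∨ (∀ t, γ₁ t = γ₂ (c - t))) ∧
      ∀ s : ℝ → ℝ, Continuous s → StrictMono s → (∀ t, γ₁ t = γ₂ (s t)) →
        ∃ c : ℝ, ∀ t, s t = t + c := by
  obtain ⟨a, α, y, y₁, y₂, h⟩ := h₁.exists_lift
  obtain ⟨b, β, z, z₁, z₂, h'⟩ := h₂.exists_lift
  constructor
  · obtain ⟨σ, hσ, he⟩ := h.exists_continuous_reparam h' hreg
    obtain ⟨c, hc⟩ := h.eq_add_or_eq_sub h' hreg hell hσ he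
    exact ⟨c, hc.imp (fun hc t => by rw [he, hc]) fun hc t => by rw [he, hc]⟩
  · intro s hs hmono he
    obtain ⟨c, hc | hc⟩ := h.eq_add_or_eq_sub h' hreg hell hs he
    · exact ⟨c, hc⟩
    · have := hmono zero_lt_one
      rw [hc, hc] at this
      linarith
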